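/- Let $d\ge 1$ and let $\Omega$ be the space of all sequences $\omega=(P_n,Q_n,R_n)_{n\in\mathbb Z}$ of triples of nonnegative $d\times d$ matrices such that $P_n+Q_n+R_n$ is stochastic for every $n$, with the product $\sigma$-algebra and the shift $(\theta\omega)_n=\omega_{n+1}$. Let $P$ be a probability measure on $\Omega$, with expectation $E$, satisfying Condition C: (C1) $P$ is $\theta$-invariant and ergodic; (C2) $E\log(1-\|R_n+P_n\|)^{-1}<\infty$ and $E\log(1-\|R_n+Q_n\|)^{-1}<\infty$, where $\|A\|=\max_i\sum_j|A(i,j)|$ (in particular both norms are $<1$ almost surely); (C3) for all $n\in\mathbb Z$ and $j\in\{1,\dots,d\}$, $P$-almost surely $\sum_iQ_n(i,j)>0$ and $\sum_iP_n(i,j)>0$; (C4) with positive $P$-probability, any two sites of layer $0$ can be reached from each other by the walk described next. Let $(\mu_\omega)_{\omega\in\Omega}$ be a measurable family of probability (row) vectors on $\{1,\dots,d\}$. Given $\omega$, let $X_t=(\xi_t,Y_t)$, $t\ge0$, be the time-homogeneous Markov chain on $\mathbb Z\times\{1,\dots,d\}$ with transition probabilities $$(n,i)\to(n+1,j):\ P_n(i,j),\qquad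 (n,i)\to(n,j):\ R_n(i,j),\qquad (n,i)\to(n-1,j):\ Q_n(i,j),$$ and with initial distribution $\xi_0=0$, $Y_0\sim\mu_\omega$; let $P_\omega^\mu$ be its law (the quenched law). Let $\mathbb P(F\times G)=\int_F P_\omega^\mu(G)\,P(d\omega)$ be the annealed law, with expectation $\mathbb E$, and let $T_1=\inf\{t:\xi_t=1\}\in[0,\infty]$. Assume that $\xi_t\to+\infty$ as $t\to\infty$, $\mathbb P$-almost surely. Then for $P$-almost every $\omega$ there is exactly one sequence $(\zeta_n)_{n\in\mathbb Z}$ of stochastic $d\times d$ matrices such that, for all $n\in\mathbb Z$, the matrix $I-Q_n\zeta_{n-1}-R_n$ is invertible and $$\zeta_n=(I-Q_n\zeta_{n-1}-R_n)^{-1}P_n ,$$ and, with $$A_n=(I-Q_n\zeta_{n-1}-R_n)^{-1}Q_n,\qquad u_n=(I-Q_n\zeta_{n-1}-R_n)^{-1}\mathbf 1,$$ where $\mathbf 1$ is the column vector of ones, the annealed mean hitting time of layer $1$ is $$\mathbb E\,T_1=E\Bigl[\mu_\omega\bigl(u_0+A_0u_{-1}+A_0A_{-1}u_{-2}+\cdots+A_0A_{-1}\cdots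 A_{-k}u_{-k-1}+\cdots\bigr)\Bigr],$$ an equality in $[0,\infty]$. -/

import Mathlib

open MeasureTheory ProbabilityTheory Filter
open scoped ENNReal Matrix

namespace StripRWRE

/-! ### Environments -/

/-- The transition data `(P, Q, R)` of one layer of the strip: three nonnegative `d × d` matrices
whose sum is a stochastic matrix. -/
structure Layer (d : ℕ) where
  P : Matrix (Fin d) (Fin d) ℝ
  Q : Matrix (Fin d) (Fin d) ℝ
  R : Matrix (Fin d) (Fin d) ℝ
  P_nonneg : ∀ i j, 0 ≤ P i j
  Q_nonneg : ∀ i j, 0 ≤ Q i j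
  R_nonneg : ∀ i j, 0 ≤ R i j
  stochastic : (P + Q + R) *ᵥ 1 = 1

/-- The σ-algebra on `Layer d` generated by the entries of the three matrices. -/
instance (d : ℕ) : MeasurableSpace (Layer d) :=
  MeasurableSpace.comap
    (fun L : Layer d => fun a : Fin d × Fin d => (L.P a.1 a.2, L.Q a.1 a.2, L.R a.1 a.2))
    inferInstance

/-- The space `Ω` of environments `ω = (P_n, Q_n, R_n)_{n ∈ ℤ}`, with the product σ-algebra. -/
abbrev Env (d : ℕ) : Type := ℤ → Layer d

/-- The shift `(θ ω)_n = ω_{n+1}`. -/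
def shift {d : ℕ} (ω : Env d) : Env d := fun n => ω (n + 1)

/-! ### The walk in a fixed environment -/

/-- The strip `ℤ × {1, …, d}`. -/
abbrev Site (d : ℕ) : Type := ℤ × Fin d

/-- The transition probabilities of the walk in the environment `ω`. -/
def transProb {d : ℕ} (ω : Env d) (z z' : Site d) : ℝ :=
  if z'.1 = z.1 + 1 then (ω z.1).P z.2 z'.2
  else if z'.1 = z.1 then (ω z.1).R z.2 z'.2
  else if z'.1 = z.1 - 1 then (ω z.1).Q z.2 z'.2
  else 0

/-- The law of one step of the walk from `z`. -/
noncomputable def stepMeasure {d : ℕ} (ω : Env d) (z : Site d) : Measure (Site d) :=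
  Measure.sum fun z' => ENNReal.ofReal (transProb ω z z') • Measure.dirac z'

theorem stepMeasure_singleton {d : ℕ} (ω : Env d) (z z' : Site d) :
    stepMeasure ω z {z'} = ENNReal.ofReal (transProb ω z z') := by
  rw [stepMeasure, Measure.sum_apply _ (measurableSet_singleton _), tsum_eq_single z']
  · simp
  · intro b hb
    simp [hb]

theorem stepMeasure_univ {d : ℕ} (ω : Env d) (z : Site d) :
    stepMeasure ω z Set.univ = 1 := by
  have hs : ∑ j, ((ω z.1).P z.2 j + (ω z.1).Q z.2 j + (ω z.1).R z.2 j) = 1 := by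
    have h := congrFun (ω z.1).stochastic z.2
    simpa [Matrix.mulVec, dotProduct] using h
  have h1 : stepMeasure ω z Set.univ
      = ∑' n : ℤ, ∑ j : Fin d, ENNReal.ofReal (transProb ω z (n, j)) := by
    rw [stepMeasure, Measure.sum_apply _ MeasurableSet.univ]
    simp only [Measure.smul_apply, measure_univ, smul_eq_mul, mul_one]
    rw [ENNReal.tsum_prod']
    simp [tsum_fintype]
  rw [h1, tsum_eq_sum (s := {z.1 + 1, z.1, z.1 - 1})]
  · have e1 : z.1 + 1 ∉ ({z.1, z.1 - 1} : Finset ℤ) := by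
      simp only [Finset.mem_insert, Finset.mem_singleton]; omega
    have e2 : z.1 ∉ ({z.1 - 1} : Finset ℤ) := by
      simp only [Finset.mem_singleton]; omega
    rw [Finset.sum_insert e1, Finset.sum_insert e2, Finset.sum_singleton]
    have a1 : ∀ j, transProb ω z (z.1 + 1, j) = (ω z.1).P z.2 j := by
      intro j; simp [transProb]
    have a2 : ∀ j, transProb ω z (z.1, j) = (ω z.1).R z.2 j := by
      intro j; simp [transProb]
    have a3 : ∀ j, transProb ω z (z.1 - 1, j) = (ω z.1).Q z.2 j := by
      intro j
      have b1 : ¬ (z.1 - 1 = z.1 + 1) := by omega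
      have b2 : ¬ (z.1 - 1 = z.1) := by omega
      simp [transProb, b1]
    simp only [a1, a2, a3]
    rw [← ENNReal.ofReal_sum_of_nonneg (fun j _ => (ω z.1).P_nonneg z.2 j),
      ← ENNReal.ofReal_sum_of_nonneg (fun j _ => (ω z.1).Q_nonneg z.2 j),
      ← ENNReal.ofReal_sum_of_nonneg (fun j _ => (ω z.1).R_nonneg z.2 j),
      ← ENNReal.ofReal_add, ← ENNReal.ofReal_add, ← ENNReal.ofReal_one, ← hs]
    · congr 1
      simp only [Finset.sum_add_distrib]
      ring
    all_goals first
      | exact Finset.sum_nonneg fun j _ => (ω z.1).P_nonneg z.2 j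
      | exact Finset.sum_nonneg fun j _ => (ω z.1).Q_nonneg z.2 j
      | exact Finset.sum_nonneg fun j _ => (ω z.1).R_nonneg z.2 j
      | exact add_nonneg (Finset.sum_nonneg fun j _ => (ω z.1).R_nonneg z.2 j)
          (Finset.sum_nonneg fun j _ => (ω z.1).Q_nonneg z.2 j)
  · intro n hn
    simp only [Finset.mem_insert, Finset.mem_singleton, not_or] at hn
    simp [transProb, hn.1, hn.2.1, hn.2.2]

/-- The one-step transition kernel of the walk in the environment `ω`. -/
noncomputable def stepKernel {d : ℕ} (ω : Env d) : Kernel (Site d) (Site d) where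
  toFun := stepMeasure ω
  measurable' := measurable_of_countable _

instance {d : ℕ} (ω : Env d) : IsMarkovKernel (stepKernel ω) :=
  ⟨fun z => ⟨stepMeasure_univ ω z⟩⟩

/-- The step kernel as a function of the whole past: only the current site matters. -/
noncomputable def pastKernel {d : ℕ} (ω : Env d) (n : ℕ) :
    Kernel (Π _ : Finset.Iic n, Site d) (Site d) :=
  (stepKernel ω).comap (fun x => x ⟨n, Finset.mem_Iic.2 le_rfl⟩) (measurable_pi_apply _)

instance {d : ℕ} (ω : Env d) (n : ℕ) : IsMarkovKernel (pastKernel ω n) := by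
  unfold pastKernel; infer_instance

/-- The quenched law: the law on path space of the time-homogeneous Markov chain with transition
probabilities `transProb ω` started at `(0, y)`, where `y` has law `μ ω`.  A measurable family
`(μ_ω)` of probability vectors on `{1, …, d}` is a Markov kernel `μ` from `Ω` to `Fin d`. -/
noncomputable def quenchedMeasure {d : ℕ} (μ : Kernel (Env d) (Fin d)) (ω : Env d) :
    Measure (ℕ → Site d) :=
  Kernel.trajMeasure (X := fun _ => Site d)
    ((μ ω).map (fun y => ((0 : ℤ), y))) (pastKernel ω)

instance {d : ℕ} (μ : Kernel (Env d) (Fin d)) [IsMarkovKernel μ] (ω : Env d) :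
    IsProbabilityMeasure (quenchedMeasure μ ω) := by
  have : IsProbabilityMeasure ((μ ω).map (fun y => ((0 : ℤ), y))) :=
    Measure.isProbabilityMeasure_map (measurable_of_countable _).aemeasurable
  unfold quenchedMeasure; infer_instance

/-- The finite-dimensional distributions of the quenched law. -/
theorem quenchedMeasure_cylinder {d : ℕ} (μ : Kernel (Env d) (Fin d)) [IsMarkovKernel μ]
    (ω : Env d) (s : ℕ → Site d) (n : ℕ) :
    quenchedMeasure μ ω {x | ∀ k ≤ n, x k = s k}
      = (if (s 0).1 = 0 then μ ω {(s 0).2} else 0)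
        * ∏ k ∈ Finset.range n, ENNReal.ofReal (transProb ω (s k) (s (k + 1))) := by
  have hμ : IsProbabilityMeasure ((μ ω).map (fun y => ((0 : ℤ), y))) :=
    Measure.isProbabilityMeasure_map (measurable_of_countable _).aemeasurable
  induction n with
  | zero =>
    have h0 : (Kernel.traj (X := fun _ => Site d) (pastKernel ω) 0).map
        (fun x : ℕ → Site d => x 0)
        = Kernel.deterministic (fun x : (Π _ : Finset.Iic 0, Site d) =>
            x ⟨0, Finset.mem_Iic.2 le_rfl⟩) (measurable_pi_apply _) := by
      have hf : (fun x : ℕ → Site d => x 0)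
          = (fun x : (Π _ : Finset.Iic 0, Site d) => x ⟨0, Finset.mem_Iic.2 le_rfl⟩)
            ∘ (Preorder.frestrictLe (π := fun _ => Site d) 0) := rfl
      rw [hf, Kernel.map_comp_right _ (by fun_prop) (by fun_prop), Kernel.traj_map_frestrictLe,
        Kernel.partialTraj_self]
      ext x : 1
      rw [Kernel.map_apply _ (by fun_prop), Kernel.id_apply, Kernel.deterministic_apply,
        Measure.map_dirac' (measurable_pi_apply _)]
    have h1 : (quenchedMeasure μ ω).map (fun x => x 0)
        = (μ ω).map (fun y => ((0 : ℤ), y)) := by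
      rw [quenchedMeasure, Kernel.trajMeasure, Measure.map_comp _ _ (by fun_prop), h0,
        Measure.deterministic_comp_eq_map, Measure.map_map (by fun_prop) (by fun_prop)]
      exact Measure.map_id
    have h2 : {x : ℕ → Site d | ∀ k ≤ 0, x k = s k} = (fun x => x 0) ⁻¹' {s 0} := by
      ext x; simp
    rw [h2, ← Measure.map_apply (measurable_pi_apply _) (measurableSet_singleton _), h1,
      Measure.map_apply (measurable_of_countable _) (measurableSet_singleton _)]
    simp only [Finset.range_zero, Finset.prod_empty, mul_one]
    split_ifs with h
    · congr 1
      ext y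
      simp [Prod.ext_iff, h]
    · have : (fun y : Fin d => ((0 : ℤ), y)) ⁻¹' {s 0} = ∅ := by
        ext y
        simp only [Set.mem_preimage, Set.mem_singleton_iff, Prod.ext_iff, Set.mem_empty_iff_false,
          iff_false, not_and]
        intro h'
        exact absurd h'.symm h
      rw [this, measure_empty]
  | succ n ih =>
    have h2 : {x : ℕ → Site d | ∀ k ≤ n + 1, x k = s k}
        = (fun x => (Preorder.frestrictLe (π := fun _ => Site d) n x, x (n + 1))) ⁻¹'
          ({Preorder.frestrictLe (π := fun _ => Site d) n s} ×ˢ {s (n + 1)}) := by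
      ext x
      simp only [Set.mem_ofPred_eq, Set.mem_preimage, Set.mem_prod, Set.mem_singleton_iff,
        funext_iff, Subtype.forall, Finset.mem_Iic, Preorder.frestrictLe_apply]
      constructor
      · intro h
        exact ⟨fun a ha => h a (by omega), h _ le_rfl⟩
      · rintro ⟨h, h'⟩ k hk
        rcases Nat.lt_or_ge n k with hlt | hge
        · obtain rfl : k = n + 1 := by omega
          exact h'
        · exact h k hge
    have h3 : {x : ℕ → Site d | ∀ k ≤ n, x k = s k}
        = (Preorder.frestrictLe (π := fun _ => Site d) n) ⁻¹'
          {Preorder.frestrictLe (π := fun _ => Site d) n s} := by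
      ext x
      simp only [Set.mem_ofPred_eq, Set.mem_preimage, Set.mem_singleton_iff,
        funext_iff, Subtype.forall, Finset.mem_Iic, Preorder.frestrictLe_apply]
    have hms : MeasurableSet
        ({Preorder.frestrictLe (π := fun _ => Site d) n s} ×ˢ {s (n + 1)} :
          Set ((Π _ : Finset.Iic n, Site d) × Site d)) :=
      (measurableSet_singleton _).prod (measurableSet_singleton _)
    rw [h3, ← Measure.map_apply (by fun_prop) (measurableSet_singleton _)] at ih
    rw [h2, ← Measure.map_apply (by fun_prop) hms, quenchedMeasure,
      ← Kernel.map_frestrictLe_trajMeasure_compProd_eq_map_trajMeasure, ← quenchedMeasure]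
    have : IsProbabilityMeasure ((quenchedMeasure μ ω).map
        (Preorder.frestrictLe (π := fun _ => Site d) n)) :=
      Measure.isProbabilityMeasure_map (by fun_prop)
    rw [Measure.compProd_apply_prod (measurableSet_singleton _) (measurableSet_singleton _),
      lintegral_singleton, ih, Finset.prod_range_succ]
    have h4 : pastKernel ω n (Preorder.frestrictLe (π := fun _ => Site d) n s) {s (n + 1)}
        = ENNReal.ofReal (transProb ω (s n) (s (n + 1))) :=
      stepMeasure_singleton ω (s n) (s (n + 1))
    rw [h4]
    ring

theorem measurable_transProb {d : ℕ} (z z' : Site d) :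
    Measurable fun ω : Env d => transProb ω z z' := by
  have h : ∀ (n : ℤ) (i j : Fin d), Measurable fun ω : Env d =>
      ((ω n).P i j, (ω n).Q i j, (ω n).R i j) := by
    intro n i j
    have h1 : Measurable fun L : Layer d => fun a : Fin d × Fin d =>
        (L.P a.1 a.2, L.Q a.1 a.2, L.R a.1 a.2) := comap_measurable _
    exact ((measurable_pi_apply (i, j)).comp h1).comp (measurable_pi_apply n)
  unfold transProb
  split_ifs
  · exact (h _ _ _).fst
  · exact (h _ _ _).snd.snd
  · exact (h _ _ _).snd.fst
  · exact measurable_const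

theorem measurable_quenchedMeasure {d : ℕ} (μ : Kernel (Env d) (Fin d)) [IsMarkovKernel μ] :
    Measurable (quenchedMeasure μ) := by
  refine Measurable.measure_of_isPiSystem_of_isProbabilityMeasure
    (generateFrom_measurableCylinders (α := fun _ : ℕ => Site d)).symm
    isPiSystem_measurableCylinders ?_
  intro t ht
  obtain ⟨I, S, hS, rfl⟩ := (mem_measurableCylinders t).1 ht
  set n := I.sup id with hn
  have hI : I ⊆ Finset.Iic n := fun k hk => Finset.mem_Iic.2 (Finset.le_sup (f := id) hk)
  set T : Set (Π _ : Finset.Iic n, Site d) := (Finset.restrict₂ (π := fun _ => Site d) hI) ⁻¹' S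
    with hT
  have h1 : cylinder I S = (Preorder.frestrictLe (π := fun _ => Site d) n) ⁻¹' T := rfl
  have h2 : ∀ ω, quenchedMeasure μ ω (cylinder I S)
      = ∑' x : T, (quenchedMeasure μ ω).map (Preorder.frestrictLe (π := fun _ => Site d) n) {x.1} := by
    intro ω
    rw [h1, ← Measure.map_apply (by fun_prop) (Set.to_countable T).measurableSet]
    simpa using (tsum_measure_preimage_singleton (f := id) (Set.to_countable T)
      (fun y _ => measurableSet_singleton y)).symm
  simp_rw [h2]
  refine Measurable.tsum fun x => ?_
  set s : ℕ → Site d := fun k => x.1 ⟨min k n, Finset.mem_Iic.2 (min_le_right _ _)⟩ with hs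
  have h3 : (Preorder.frestrictLe (π := fun _ => Site d) n) ⁻¹' {x.1}
      = {y : ℕ → Site d | ∀ k ≤ n, y k = s k} := by
    ext y
    simp only [Set.mem_ofPred_eq, Set.mem_preimage, Set.mem_singleton_iff,
      funext_iff, Subtype.forall, Finset.mem_Iic, Preorder.frestrictLe_apply]
    refine forall₂_congr fun k hk => ?_
    simp [hs, hk]
  have h4 : ∀ ω, (quenchedMeasure μ ω).map (Preorder.frestrictLe (π := fun _ => Site d) n) {x.1}
      = (if (s 0).1 = 0 then μ ω {(s 0).2} else 0)
        * ∏ k ∈ Finset.range n, ENNReal.ofReal (transProb ω (s k) (s (k + 1))) := by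
    intro ω
    rw [Measure.map_apply (by fun_prop) (measurableSet_singleton _), h3, quenchedMeasure_cylinder]
  simp_rw [h4]
  refine Measurable.mul ?_ (Finset.measurable_fun_prod _ fun k _ =>
    (measurable_transProb _ _).ennreal_ofReal)
  split_ifs
  · exact μ.measurable_coe (measurableSet_singleton _)
  · exact measurable_const

/-- The quenched laws as a kernel from environments to paths. -/
noncomputable def quenched {d : ℕ} (μ : Kernel (Env d) (Fin d)) [IsMarkovKernel μ] :
    Kernel (Env d) (ℕ → Site d) where
  toFun := quenchedMeasure μ
  measurable' := measurable_quenchedMeasure μ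

instance {d : ℕ} (μ : Kernel (Env d) (Fin d)) [IsMarkovKernel μ] : IsMarkovKernel (quenched μ) :=
  ⟨fun ω => inferInstanceAs (IsProbabilityMeasure (quenchedMeasure μ ω))⟩

/-- The annealed law `F × G ↦ ∫_F P_ω^μ(G) P(dω)` on environments and paths. -/
noncomputable def annealed {d : ℕ} (Pr : Measure (Env d)) (μ : Kernel (Env d) (Fin d))
    [IsMarkovKernel μ] : Measure (Env d × (ℕ → Site d)) :=
  Pr ⊗ₘ quenched μ

/-- The hitting time of layer `n`, equal to `∞` if the layer is never reached. -/
noncomputable def hittingTime {d : ℕ} (n : ℤ) (x : ℕ → Site d) : ℕ∞ :=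
  ⨅ (t : ℕ) (_ : (x t).1 = n), (t : ℕ∞)

/-! ### Condition C -/

/-- `‖A‖ = max_i ∑_j |A i j|`. -/
noncomputable def rowNorm {d : ℕ} (A : Matrix (Fin d) (Fin d) ℝ) : ℝ :=
  ⨆ i, ∑ j, |A i j|

/-- `z'` can be reached from `z` by the walk in the environment `ω`. -/
def Reachable {d : ℕ} (ω : Env d) (z z' : Site d) : Prop :=
  Relation.ReflTransGen (fun a b => 0 < transProb ω a b) z z'

/-- Condition C on the law `Pr` of the environment.  Since the norms in C2 are at most `1`, finiteness
of the (extended) expectation `E log (1 - ‖·‖)⁻¹` means that the norm is almost surely `< 1` and that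
the logarithm is integrable. -/
structure ConditionC {d : ℕ} (Pr : Measure (Env d)) : Prop where
  ergodic : Ergodic shift Pr
  lt_one_right : ∀ n : ℤ, ∀ᵐ ω ∂Pr, rowNorm ((ω n).R + (ω n).P) < 1
  log_right : ∀ n : ℤ,
    Integrable (fun ω => Real.log (1 - rowNorm ((ω n).R + (ω n).P))⁻¹) Pr
  lt_one_left : ∀ n : ℤ, ∀ᵐ ω ∂Pr, rowNorm ((ω n).R + (ω n).Q) < 1
  log_left : ∀ n : ℤ,
    Integrable (fun ω => Real.log (1 - rowNorm ((ω n).R + (ω n).Q))⁻¹) Pr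
  columns_pos : ∀ (j : Fin d) (n : ℤ), ∀ᵐ ω ∂Pr, 0 < ∑ i, (ω n).Q i j ∧ 0 < ∑ i, (ω n).P i j
  communicate : 0 < Pr {ω | ∀ i j : Fin d, Reachable ω (0, i) (0, j)}

/-! ### The matrices `ζ_n`, `A_n` and the vectors `u_n` -/

/-- The matrix `I - Q_n ζ_{n-1} - R_n`. -/
def coreMatrix {d : ℕ} (ω : Env d) (ζ : ℤ → Matrix (Fin d) (Fin d) ℝ) (n : ℤ) :
    Matrix (Fin d) (Fin d) ℝ :=
  1 - (ω n).Q * ζ (n - 1) - (ω n).R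

/-- `ζ` is a sequence of stochastic matrices with `ζ_n = (I - Q_n ζ_{n-1} - R_n)⁻¹ P_n`, the inverse
matrices existing. -/
def IsZeta {d : ℕ} (ω : Env d) (ζ : ℤ → Matrix (Fin d) (Fin d) ℝ) : Prop :=
  ∀ n : ℤ, ζ n ∈ Matrix.rowStochastic ℝ (Fin d) ∧ IsUnit (coreMatrix ω ζ n) ∧
    ζ n = (coreMatrix ω ζ n)⁻¹ * (ω n).P

/-- `A_n = (I - Q_n ζ_{n-1} - R_n)⁻¹ Q_n`. -/
noncomputable def matA {d : ℕ} (ω : Env d) (ζ : ℤ → Matrix (Fin d) (Fin d) ℝ) (n : ℤ) :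
    Matrix (Fin d) (Fin d) ℝ :=
  (coreMatrix ω ζ n)⁻¹ * (ω n).Q

/-- `u_n = (I - Q_n ζ_{n-1} - R_n)⁻¹ 1`. -/
noncomputable def vecU {d : ℕ} (ω : Env d) (ζ : ℤ → Matrix (Fin d) (Fin d) ℝ) (n : ℤ) :
    Fin d → ℝ :=
  (coreMatrix ω ζ n)⁻¹ *ᵥ 1

/-- The product `A_0 A_{-1} ⋯ A_{-(k-1)}` of `k` factors. -/
noncomputable def prodA {d : ℕ} (ω : Env d) (ζ : ℤ → Matrix (Fin d) (Fin d) ℝ) :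
    ℕ → Matrix (Fin d) (Fin d) ℝ
  | 0 => 1
  | k + 1 => prodA ω ζ k * matA ω ζ (-(k : ℤ))

/-- The row vector of a measure on `{1, …, d}`. -/
noncomputable def rowVec {d : ℕ} (ν : Measure (Fin d)) : Fin d → ℝ := fun i => ν.real {i}

end StripRWRE

namespace StripRWRE

open scoped Topology

variable {d : ℕ}

/-! ### Nonnegative matrices -/

theorem mulVec_mono {M : Matrix (Fin d) (Fin d) ℝ} (hM : ∀ i j, 0 ≤ M i j) {v w : Fin d → ℝ}
    (h : v ≤ w) : M *ᵥ v ≤ M *ᵥ w := by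
  intro i
  simp only [Matrix.mulVec, dotProduct]
  exact Finset.sum_le_sum fun j _ => mul_le_mul_of_nonneg_left (h j) (hM i j)

theorem mulVec_nonneg {M : Matrix (Fin d) (Fin d) ℝ} (hM : ∀ i j, 0 ≤ M i j) {v : Fin d → ℝ}
    (h : 0 ≤ v) : 0 ≤ M *ᵥ v := by
  intro i
  simp only [Matrix.mulVec, dotProduct]
  exact Finset.sum_nonneg fun j _ => mul_nonneg (hM i j) (h j)

theorem mul_mono {A B C D : Matrix (Fin d) (Fin d) ℝ} (hA : ∀ i j, 0 ≤ A i j)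
    (hD : ∀ i j, 0 ≤ D i j) (h : ∀ i j, A i j ≤ B i j) (h' : ∀ i j, C i j ≤ D i j) (i j : Fin d) :
    (A * C) i j ≤ (B * D) i j := by
  simp only [Matrix.mul_apply]
  exact Finset.sum_le_sum fun k _ =>
    (mul_le_mul_of_nonneg_left (h' k j) (hA i k)).trans
      (mul_le_mul_of_nonneg_right (h i k) (hD k j))

theorem mul_entry_nonneg {A B : Matrix (Fin d) (Fin d) ℝ} (hA : ∀ i j, 0 ≤ A i j)
    (hB : ∀ i j, 0 ≤ B i j) (i j : Fin d) : 0 ≤ (A * B) i j := by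
  simp only [Matrix.mul_apply]
  exact Finset.sum_nonneg fun k _ => mul_nonneg (hA i k) (hB k j)

theorem mulVec_le_mulVec_of_entry_le {A B : Matrix (Fin d) (Fin d) ℝ} {v : Fin d → ℝ}
    (h : ∀ i j, A i j ≤ B i j) (hv : 0 ≤ v) : A *ᵥ v ≤ B *ᵥ v := by
  intro i
  simp only [Matrix.mulVec, dotProduct]
  exact Finset.sum_le_sum fun j _ => mul_le_mul_of_nonneg_right (h i j) (hv j)

/-- Minimum principle for a nonnegative matrix whose row sums are less than one. -/
theorem nonneg_of_mulVec_le {M : Matrix (Fin d) (Fin d) ℝ} (hM : ∀ i j, 0 ≤ M i j)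
    (hs : ∀ i, (M *ᵥ 1) i < 1) {x : Fin d → ℝ} (hx : M *ᵥ x ≤ x) : 0 ≤ x := by
  intro k
  have : Nonempty (Fin d) := ⟨k⟩
  obtain ⟨i, hi⟩ := Finite.exists_min x
  have h1 : (M *ᵥ 1) i * x i ≤ (M *ᵥ x) i := by
    simp only [Matrix.mulVec, dotProduct, Finset.sum_mul, Pi.one_apply, mul_one]
    exact Finset.sum_le_sum fun j _ => mul_le_mul_of_nonneg_left (hi j) (hM i j)
  have h2 := hx i
  have h3 := hs i
  have h4 : 0 ≤ x i := by
    by_contra! h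
    nlinarith
  exact h4.trans (hi k)

theorem isUnit_one_sub {M : Matrix (Fin d) (Fin d) ℝ} (hM : ∀ i j, 0 ≤ M i j)
    (hs : ∀ i, (M *ᵥ 1) i < 1) : IsUnit (1 - M) := by
  rw [← Matrix.mulVec_injective_iff_isUnit]
  have key : ∀ x y : Fin d → ℝ, (1 - M) *ᵥ x = (1 - M) *ᵥ y → x ≤ y := by
    intro x y h
    rw [← sub_nonneg]
    refine nonneg_of_mulVec_le hM hs (le_of_eq ?_)
    simp only [Matrix.sub_mulVec, Matrix.one_mulVec] at h
    rw [Matrix.mulVec_sub]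
    linear_combination h
  exact fun x y h => le_antisymm (key x y h) (key y x h.symm)

theorem inv_one_sub_mulVec_nonneg {M : Matrix (Fin d) (Fin d) ℝ} (hM : ∀ i j, 0 ≤ M i j)
    (hs : ∀ i, (M *ᵥ 1) i < 1) {v : Fin d → ℝ} (hv : 0 ≤ v) : 0 ≤ (1 - M)⁻¹ *ᵥ v := by
  refine nonneg_of_mulVec_le hM hs ?_
  have h : (1 - M) *ᵥ ((1 - M)⁻¹ *ᵥ v) = v := by
    rw [Matrix.mulVec_mulVec, Matrix.mul_nonsing_inv _
      ((Matrix.isUnit_iff_isUnit_det _).1 (isUnit_one_sub hM hs)), Matrix.one_mulVec]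
  rw [Matrix.sub_mulVec, Matrix.one_mulVec] at h
  rw [← sub_nonneg, h]
  exact hv

/-! ### The step operator and first passage probabilities -/

theorem Layer.row_sum (L : Layer d) : L.P *ᵥ 1 + L.R *ᵥ 1 + L.Q *ᵥ 1 = 1 := by
  have := L.stochastic
  simp only [Matrix.add_mulVec] at this
  rw [add_right_comm]
  exact this

/-- The transition operator of the walk, on functions on the strip written layer by layer. -/
def stepOp (ω : Env d) (φ : ℤ → Fin d → ℝ) (n : ℤ) : Fin d → ℝ :=
  (ω n).P *ᵥ φ (n + 1) + (ω n).R *ᵥ φ n + (ω n).Q *ᵥ φ (n - 1)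

theorem stepOp_mono {ω : Env d} {φ ψ : ℤ → Fin d → ℝ} {n : ℤ} (h1 : φ (n + 1) ≤ ψ (n + 1))
    (h2 : φ n ≤ ψ n) (h3 : φ (n - 1) ≤ ψ (n - 1)) : stepOp ω φ n ≤ stepOp ω ψ n :=
  add_le_add (add_le_add (mulVec_mono (ω n).P_nonneg h1) (mulVec_mono (ω n).R_nonneg h2))
    (mulVec_mono (ω n).Q_nonneg h3)

theorem stepOp_nonneg {ω : Env d} {φ : ℤ → Fin d → ℝ} (h : ∀ n, 0 ≤ φ n) (n : ℤ) :
    0 ≤ stepOp ω φ n :=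
  add_nonneg (add_nonneg (mulVec_nonneg (ω n).P_nonneg (h _)) (mulVec_nonneg (ω n).R_nonneg (h _)))
    (mulVec_nonneg (ω n).Q_nonneg (h _))

theorem stepOp_add (ω : Env d) (φ ψ : ℤ → Fin d → ℝ) (n : ℤ) :
    stepOp ω (fun k => φ k + ψ k) n = stepOp ω φ n + stepOp ω ψ n := by
  simp only [stepOp, Matrix.mulVec_add]; abel

/-- The probability that the walk from layer `n` stays below layer `m` at the times `0, …, t`. -/
def survival (ω : Env d) (m : ℤ) : ℕ → ℤ → Fin d → ℝ
  | 0 => fun n => if n < m then 1 else 0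
  | t + 1 => fun n => if n < m then stepOp ω (survival ω m t) n else 0

/-- The mean of the minimum of `t` and the hitting time of layer `m`, from a layer `n ≤ m`. -/
def truncMean (ω : Env d) (m : ℤ) : ℕ → ℤ → Fin d → ℝ
  | 0 => 0
  | t + 1 => fun n => if n < m then 1 + stepOp ω (truncMean ω m t) n else 0

/-- The probability of hitting layer `m` by the time `t`, first at the site given by the second
index, from a layer `n ≤ m`. -/
def hitMat (ω : Env d) (m : ℤ) : ℕ → ℤ → Matrix (Fin d) (Fin d) ℝ
  | 0 => fun n => if n = m then 1 else 0
  | t + 1 => fun n => if n = m then 1 else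
      (ω n).P * hitMat ω m t (n + 1) + (ω n).R * hitMat ω m t n + (ω n).Q * hitMat ω m t (n - 1)

theorem survival_nonneg (ω : Env d) (m : ℤ) (t : ℕ) (n : ℤ) : 0 ≤ survival ω m t n := by
  induction t generalizing n with
  | zero => simp only [survival]; split_ifs <;> simp
  | succ t ih =>
    simp only [survival]
    split_ifs
    · exact stepOp_nonneg ih n
    · exact le_rfl

theorem truncMean_succ (ω : Env d) (m : ℤ) (t : ℕ) (n : ℤ) :
    truncMean ω m (t + 1) n = truncMean ω m t n + survival ω m t n := by
  induction t generalizing n with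
  | zero =>
    simp only [truncMean, survival]
    split_ifs <;> simp [stepOp]
  | succ t ih =>
    rw [truncMean, survival, truncMean]
    beta_reduce
    split_ifs
    · rw [add_assoc, ← stepOp_add]
      congr 2
      funext k
      exact ih k
    · simp

theorem truncMean_eq_sum (ω : Env d) (m : ℤ) (t : ℕ) (n : ℤ) :
    truncMean ω m t n = ∑ s ∈ Finset.range t, survival ω m s n := by
  induction t with
  | zero => simp [truncMean]
  | succ t ih => rw [truncMean_succ, ih, Finset.sum_range_succ]

theorem truncMean_mono (ω : Env d) (m : ℤ) (n : ℤ) : Monotone fun t => truncMean ω m t n :=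
  monotone_nat_of_le_succ fun t => by
    rw [truncMean_succ]; exact le_add_of_nonneg_right (survival_nonneg ω m t n)

theorem truncMean_nonneg (ω : Env d) (m : ℤ) (t : ℕ) (n : ℤ) : 0 ≤ truncMean ω m t n := by
  rw [truncMean_eq_sum]
  exact Finset.sum_nonneg fun s _ => survival_nonneg ω m s n

theorem hitMat_nonneg (ω : Env d) (m : ℤ) (t : ℕ) (n : ℤ) (i j : Fin d) :
    0 ≤ hitMat ω m t n i j := by
  have h1 : ∀ i j : Fin d, 0 ≤ (1 : Matrix (Fin d) (Fin d) ℝ) i j := by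
    intro i j; rw [Matrix.one_apply]; split_ifs <;> simp
  induction t generalizing n i j with
  | zero =>
    simp only [hitMat]
    split_ifs
    · exact h1 i j
    · simp
  | succ t ih =>
    simp only [hitMat]
    split_ifs
    · exact h1 i j
    · exact add_nonneg (add_nonneg (mul_entry_nonneg (ω n).P_nonneg (ih _) i j)
        (mul_entry_nonneg (ω n).R_nonneg (ih _) i j)) (mul_entry_nonneg (ω n).Q_nonneg (ih _) i j)

theorem hitMat_mulVec_one (ω : Env d) (m : ℤ) (t : ℕ) {n : ℤ} (hn : n ≤ m) :
    hitMat ω m t n *ᵥ 1 = 1 - survival ω m t n := by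
  induction t generalizing n with
  | zero =>
    rcases hn.lt_or_eq with h | h
    · simp [hitMat, survival, h, h.ne]
    · simp [hitMat, survival, h]
  | succ t ih =>
    rcases hn.lt_or_eq with h | h
    · simp only [hitMat, survival, h, h.ne, if_true, if_false, Matrix.add_mulVec,
        ← Matrix.mulVec_mulVec]
      rw [ih (by omega), ih (by omega), ih (by omega)]
      simp only [Matrix.mulVec_sub, stepOp]
      linear_combination (ω n).row_sum
    · simp [hitMat, survival, h]

/-- Restarting the walk when it hits layer `m`. -/
theorem truncMean_add_hitMat_mulVec_le (ω : Env d) (m : ℤ) (s t : ℕ) {n : ℤ} (hn : n ≤ m) :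
    truncMean ω m s n + hitMat ω m s n *ᵥ truncMean ω (m + 1) t m
      ≤ truncMean ω (m + 1) (s + t) n := by
  induction s generalizing n with
  | zero =>
    rcases hn.lt_or_eq with h | h
    · simpa [truncMean, hitMat, h.ne] using truncMean_nonneg ω (m + 1) t n
    · simp [truncMean, hitMat, h]
  | succ s ih =>
    rcases hn.lt_or_eq with h | h
    · rw [show s + 1 + t = (s + t) + 1 by ring, truncMean, truncMean, hitMat]
      simp only [h, h.ne, if_true, if_false, show n < m + 1 by omega, Matrix.add_mulVec,
        ← Matrix.mulVec_mulVec]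
      have h2 := stepOp_mono (ω := ω) (n := n)
        (φ := fun k => truncMean ω m s k + hitMat ω m s k *ᵥ truncMean ω (m + 1) t m)
        (ψ := truncMean ω (m + 1) (s + t)) (ih (by omega)) (ih (by omega)) (ih (by omega))
      rw [stepOp_add] at h2
      rw [add_assoc]
      exact add_le_add_right h2 1
    · subst h
      simp only [truncMean, hitMat, lt_irrefl, if_true, if_false, Matrix.one_mulVec, zero_add]
      exact truncMean_mono ω (n + 1) n (by omega)

/-! ### Nonnegative solutions of the equation for `ζ` -/

/-- The equation `ζ_n = P_n + R_n ζ_n + Q_n ζ_{n-1} ζ_n`, for nonnegative matrices. -/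
def IsPassage (ω : Env d) (ζ : ℤ → Matrix (Fin d) (Fin d) ℝ) : Prop :=
  ∀ n, (∀ i j, 0 ≤ ζ n i j) ∧
    ζ n = (ω n).P + (ω n).R * ζ n + (ω n).Q * (ζ (n - 1) * ζ n)

/-- The product `ζ_{m-k} ⋯ ζ_{m-1}`. -/
def passageProd (ζ : ℤ → Matrix (Fin d) (Fin d) ℝ) (m : ℤ) : ℕ → Matrix (Fin d) (Fin d) ℝ
  | 0 => 1
  | k + 1 => ζ (m - (k + 1)) * passageProd ζ m k

theorem passageProd_nonneg {ω : Env d} {ζ : ℤ → Matrix (Fin d) (Fin d) ℝ} (h : IsPassage ω ζ)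
    (m : ℤ) (k : ℕ) (i j : Fin d) : 0 ≤ passageProd ζ m k i j := by
  induction k generalizing i j with
  | zero => simp only [passageProd, Matrix.one_apply]; split_ifs <;> simp
  | succ k ih => exact mul_entry_nonneg (h _).1 ih i j

theorem hitMat_le_passageProd {ω : Env d} {ζ : ℤ → Matrix (Fin d) (Fin d) ℝ}
    (h : IsPassage ω ζ) (m : ℤ) (t k : ℕ) (i j : Fin d) :
    hitMat ω m t (m - k) i j ≤ passageProd ζ m k i j := by
  induction t generalizing k i j with
  | zero =>
    cases k with
    | zero => simp [hitMat, passageProd]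
    | succ k =>
      have : ¬ (m - ((k + 1 : ℕ) : ℤ) = m) := by omega
      simp only [hitMat, this, if_false]
      exact passageProd_nonneg h m _ i j
  | succ t ih =>
    cases k with
    | zero => simp [hitMat, passageProd]
    | succ k =>
      have hne : ¬ (m - ((k + 1 : ℕ) : ℤ) = m) := by omega
      have e : passageProd ζ m (k + 1) = (ω (m - ((k + 1 : ℕ) : ℤ))).P * passageProd ζ m k
          + (ω (m - ((k + 1 : ℕ) : ℤ))).R * passageProd ζ m (k + 1)
          + (ω (m - ((k + 1 : ℕ) : ℤ))).Q * passageProd ζ m (k + 2) := by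
        have h1 := (h (m - (k + 1))).2
        have h2 : m - ((k : ℤ) + 1) - 1 = m - (((k + 1 : ℕ) : ℤ) + 1) := by push_cast; ring
        rw [h2] at h1
        simp only [passageProd]
        conv_lhs => rw [h1]
        push_cast
        simp only [Matrix.add_mul, Matrix.mul_assoc]
      rw [e]
      simp only [hitMat, hne, if_false]
      have e1 : m - ((k + 1 : ℕ) : ℤ) + 1 = m - (k : ℤ) := by push_cast; ring
      have e2 : m - ((k + 1 : ℕ) : ℤ) - 1 = m - ((k + 2 : ℕ) : ℤ) := by push_cast; ring
      rw [e1, e2]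
      exact add_le_add (add_le_add
        (mul_mono (ω _).P_nonneg (passageProd_nonneg h m _) (fun _ _ => le_rfl) (ih k) i j)
        (mul_mono (ω _).R_nonneg (passageProd_nonneg h m _) (fun _ _ => le_rfl) (ih (k + 1)) i j))
        (mul_mono (ω _).Q_nonneg (passageProd_nonneg h m _) (fun _ _ => le_rfl) (ih (k + 2)) i j)

theorem hitMat_le_of_isPassage {ω : Env d} {ζ : ℤ → Matrix (Fin d) (Fin d) ℝ}
    (h : IsPassage ω ζ) (n : ℤ) (t : ℕ) (i j : Fin d) :
    hitMat ω (n + 1) t n i j ≤ ζ n i j := by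
  have := hitMat_le_passageProd h (n + 1) t 1 i j
  simpa [passageProd] using this

/-- If the walk hits the next layer almost surely, then the passage probabilities are the only
substochastic solution. -/
theorem tendsto_hitMat {ω : Env d} {ζ : ℤ → Matrix (Fin d) (Fin d) ℝ}
    (h : IsPassage ω ζ) (h1 : ∀ n, ζ n *ᵥ 1 ≤ 1) (n : ℤ)
    (hs : ∀ i, Tendsto (fun t => survival ω (n + 1) t n i) atTop (𝓝 0)) (i j : Fin d) :
    Tendsto (fun t => hitMat ω (n + 1) t n i j) atTop (𝓝 (ζ n i j)) := by
  have hle : ∀ t, ζ n i j - survival ω (n + 1) t n i ≤ hitMat ω (n + 1) t n i j := by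
    intro t
    have e1 := congrFun (hitMat_mulVec_one ω (n + 1) t (n := n) (by omega)) i
    have e2 := h1 n i
    simp only [Matrix.mulVec, dotProduct, Pi.one_apply, mul_one, Pi.sub_apply] at e1 e2
    have e3 : ζ n i j - hitMat ω (n + 1) t n i j
        ≤ ∑ k, (ζ n i k - hitMat ω (n + 1) t n i k) :=
      Finset.single_le_sum (f := fun k => ζ n i k - hitMat ω (n + 1) t n i k)
        (fun k _ => sub_nonneg.2 (hitMat_le_of_isPassage h n t i k)) (Finset.mem_univ j)
    rw [Finset.sum_sub_distrib] at e3
    linarith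
  refine tendsto_of_tendsto_of_tendsto_of_le_of_le ?_ tendsto_const_nhds hle
    (fun t => hitMat_le_of_isPassage h n t i j)
  simpa using tendsto_const_nhds.sub (hs i)

/-- Monotone approximation of the minimal solution. -/
def passageIter (ω : Env d) : ℕ → ℤ → Matrix (Fin d) (Fin d) ℝ
  | 0 => 0
  | t + 1 => fun n => (ω n).P + (ω n).R * passageIter ω t n
      + (ω n).Q * (passageIter ω t (n - 1) * passageIter ω t n)

theorem passageIter_nonneg (ω : Env d) (t : ℕ) (n : ℤ) (i j : Fin d) :
    0 ≤ passageIter ω t n i j := by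
  induction t generalizing n i j with
  | zero => simp [passageIter]
  | succ t ih =>
    exact add_nonneg (add_nonneg ((ω n).P_nonneg i j) (mul_entry_nonneg (ω n).R_nonneg (ih n) i j))
      (mul_entry_nonneg (ω n).Q_nonneg (mul_entry_nonneg (ih _) (ih _)) i j)

theorem passageIter_le_succ (ω : Env d) (t : ℕ) (n : ℤ) (i j : Fin d) :
    passageIter ω t n i j ≤ passageIter ω (t + 1) n i j := by
  induction t generalizing n i j with
  | zero => exact passageIter_nonneg ω 1 n i j
  | succ t ih =>
    have nn := passageIter_nonneg ω
    exact add_le_add (add_le_add le_rfl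
      (mul_mono (ω n).R_nonneg (nn _ _) (fun _ _ => le_rfl) (ih n) i j))
      (mul_mono (ω n).Q_nonneg (mul_entry_nonneg (nn _ _) (nn _ _)) (fun _ _ => le_rfl)
        (mul_mono (nn _ _) (nn _ _) (ih (n - 1)) (ih n)) i j)

theorem passageIter_mulVec_one_le (ω : Env d) (t : ℕ) (n : ℤ) :
    passageIter ω t n *ᵥ 1 ≤ 1 := by
  induction t generalizing n with
  | zero => simp [passageIter]
  | succ t ih =>
    simp only [passageIter, Matrix.add_mulVec, ← Matrix.mulVec_mulVec]
    calc _ ≤ (ω n).P *ᵥ 1 + (ω n).R *ᵥ 1 + (ω n).Q *ᵥ 1 :=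
          add_le_add (add_le_add le_rfl (mulVec_mono (ω n).R_nonneg (ih n)))
            (mulVec_mono (ω n).Q_nonneg
              ((mulVec_mono (passageIter_nonneg ω t (n - 1)) (ih n)).trans (ih _)))
      _ = 1 := (ω n).row_sum

theorem exists_isPassage (ω : Env d) :
    ∃ ζ : ℤ → Matrix (Fin d) (Fin d) ℝ, IsPassage ω ζ ∧ ∀ n, ζ n *ᵥ 1 ≤ 1 := by
  have hlim : ∀ n i j, ∃ l, Tendsto (fun t => passageIter ω t n i j) atTop (𝓝 l) := by
    intro n i j
    refine ⟨_, tendsto_atTop_ciSup (monotone_nat_of_le_succ fun t => passageIter_le_succ ω t n i j)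
      ⟨1, ?_⟩⟩
    rintro _ ⟨t, rfl⟩
    refine le_trans ?_ (passageIter_mulVec_one_le ω t n i)
    simp only [Matrix.mulVec, dotProduct, Pi.one_apply, mul_one]
    exact Finset.single_le_sum (f := fun k => passageIter ω t n i k)
      (fun k _ => passageIter_nonneg ω t n i k) (Finset.mem_univ j)
  choose l hl using hlim
  have hmul : ∀ {A B : ℕ → Matrix (Fin d) (Fin d) ℝ} {A' B' : Matrix (Fin d) (Fin d) ℝ},
      (∀ i j, Tendsto (fun t => A t i j) atTop (𝓝 (A' i j))) →
      (∀ i j, Tendsto (fun t => B t i j) atTop (𝓝 (B' i j))) →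
      ∀ i j, Tendsto (fun t => (A t * B t) i j) atTop (𝓝 ((A' * B') i j)) := by
    intro A B A' B' hA hB i j
    simp only [Matrix.mul_apply]
    exact tendsto_finsetSum _ fun k _ => (hA i k).mul (hB k j)
  have hL : ∀ n i j, Tendsto (fun t => passageIter ω t n i j) atTop (𝓝 (Matrix.of (l n) i j)) := hl
  refine ⟨fun n => Matrix.of (l n), fun n => ⟨fun i j => ?_, ?_⟩, fun n i => ?_⟩
  · exact ge_of_tendsto' (hl n i j) fun t => passageIter_nonneg ω t n i j
  · ext i j
    have h1 := hmul (A := fun _ => (ω n).R) (A' := (ω n).R) (fun _ _ => tendsto_const_nhds)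
      (hL n) i j
    have h2 := hmul (A := fun _ => (ω n).Q) (A' := (ω n).Q) (fun _ _ => tendsto_const_nhds)
      (hmul (hL (n - 1)) (hL n)) i j
    have h3 := (tendsto_const_nhds (x := (ω n).P i j)).add h1 |>.add h2
    simp only [Matrix.add_apply]
    exact tendsto_nhds_unique ((hL n i j).comp (tendsto_add_atTop_nat 1)) h3
  · have h : Tendsto (fun t => (passageIter ω t n *ᵥ 1) i) atTop
        (𝓝 ((Matrix.of (l n) *ᵥ 1) i)) := by
      simp only [Matrix.mulVec, dotProduct]
      exact tendsto_finsetSum _ fun k _ => (hL n i k).mul tendsto_const_nhds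
    exact le_of_tendsto' h fun t => passageIter_mulVec_one_le ω t n i

/-! ### Consequences of the equation for `ζ` -/

/-- The matrix `Q_n ζ_{n-1} + R_n`: the walk from layer `n` at its first return to layer `n`. -/
def returnMat (ω : Env d) (ζ : ℤ → Matrix (Fin d) (Fin d) ℝ) (n : ℤ) :
    Matrix (Fin d) (Fin d) ℝ :=
  (ω n).Q * ζ (n - 1) + (ω n).R

theorem coreMatrix_eq (ω : Env d) (ζ : ℤ → Matrix (Fin d) (Fin d) ℝ) (n : ℤ) :
    coreMatrix ω ζ n = 1 - returnMat ω ζ n := by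
  rw [coreMatrix, returnMat, sub_sub]

theorem returnMat_nonneg {ω : Env d} {ζ : ℤ → Matrix (Fin d) (Fin d) ℝ}
    (h : ∀ n, ζ n ∈ Matrix.rowStochastic ℝ (Fin d)) (n : ℤ) (i j : Fin d) :
    0 ≤ returnMat ω ζ n i j :=
  add_nonneg (mul_entry_nonneg (ω n).Q_nonneg (h _).1 i j) ((ω n).R_nonneg i j)

theorem returnMat_row_sum_lt {ω : Env d} {ζ : ℤ → Matrix (Fin d) (Fin d) ℝ}
    (h : ∀ n, ζ n ∈ Matrix.rowStochastic ℝ (Fin d))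
    (hP : ∀ n i, 0 < ((ω n).P *ᵥ 1) i) (n : ℤ) (i : Fin d) :
    (returnMat ω ζ n *ᵥ 1) i < 1 := by
  have h1 : returnMat ω ζ n *ᵥ 1 = 1 - (ω n).P *ᵥ 1 := by
    rw [returnMat, Matrix.add_mulVec, ← Matrix.mulVec_mulVec, (h _).2]
    linear_combination (ω n).row_sum
  have h2 := hP n i
  rw [h1]
  simp only [Pi.sub_apply, Pi.one_apply]
  linarith

theorem isUnit_coreMatrix {ω : Env d} {ζ : ℤ → Matrix (Fin d) (Fin d) ℝ}
    (h : ∀ n, ζ n ∈ Matrix.rowStochastic ℝ (Fin d))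
    (hP : ∀ n i, 0 < ((ω n).P *ᵥ 1) i) (n : ℤ) : IsUnit (coreMatrix ω ζ n) := by
  rw [coreMatrix_eq]
  exact isUnit_one_sub (returnMat_nonneg h n) (returnMat_row_sum_lt h hP n)

theorem inv_coreMatrix_mulVec_nonneg {ω : Env d} {ζ : ℤ → Matrix (Fin d) (Fin d) ℝ}
    (h : ∀ n, ζ n ∈ Matrix.rowStochastic ℝ (Fin d))
    (hP : ∀ n i, 0 < ((ω n).P *ᵥ 1) i) (n : ℤ) {v : Fin d → ℝ} (hv : 0 ≤ v) :
    0 ≤ (coreMatrix ω ζ n)⁻¹ *ᵥ v := by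
  rw [coreMatrix_eq]
  exact inv_one_sub_mulVec_nonneg (returnMat_nonneg h n) (returnMat_row_sum_lt h hP n) hv

theorem IsZeta.stochastic {ω : Env d} {ζ : ℤ → Matrix (Fin d) (Fin d) ℝ} (h : IsZeta ω ζ) (n : ℤ) :
    ζ n ∈ Matrix.rowStochastic ℝ (Fin d) := (h n).1

theorem IsZeta.isUnit_det {ω : Env d} {ζ : ℤ → Matrix (Fin d) (Fin d) ℝ} (h : IsZeta ω ζ) (n : ℤ) :
    IsUnit (coreMatrix ω ζ n).det := (Matrix.isUnit_iff_isUnit_det _).1 (h n).2.1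

theorem IsZeta.isPassage {ω : Env d} {ζ : ℤ → Matrix (Fin d) (Fin d) ℝ} (h : IsZeta ω ζ) :
    IsPassage ω ζ := by
  refine fun n => ⟨(h n).1.1, ?_⟩
  have h1 : coreMatrix ω ζ n * ζ n = (ω n).P := by
    conv_lhs => rw [(h n).2.2]
    rw [← Matrix.mul_assoc, Matrix.mul_nonsing_inv _ (h.isUnit_det n), Matrix.one_mul]
  rw [← h1, coreMatrix, ← Matrix.mul_assoc]
  noncomm_ring

theorem IsPassage.isZeta {ω : Env d} {ζ : ℤ → Matrix (Fin d) (Fin d) ℝ} (h : IsPassage ω ζ)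
    (h1 : ∀ n, ζ n *ᵥ 1 = 1) (hP : ∀ n i, 0 < ((ω n).P *ᵥ 1) i) : IsZeta ω ζ := by
  have hs : ∀ n, ζ n ∈ Matrix.rowStochastic ℝ (Fin d) := fun n => ⟨(h n).1, h1 n⟩
  refine fun n => ⟨hs n, isUnit_coreMatrix hs hP n, ?_⟩
  have h2 : coreMatrix ω ζ n * ζ n = (ω n).P := by
    have h3 := (h n).2
    rw [← Matrix.mul_assoc] at h3
    have h4 : coreMatrix ω ζ n * ζ n
        = ζ n - ((ω n).Q * ζ (n - 1) * ζ n) - (ω n).R * ζ n := by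
      rw [coreMatrix]; noncomm_ring
    rw [h4]
    nth_rewrite 1 [h3]
    abel
  rw [← h2, ← Matrix.mul_assoc, Matrix.nonsing_inv_mul _
    ((Matrix.isUnit_iff_isUnit_det _).1 (isUnit_coreMatrix hs hP n)), Matrix.one_mul]

/-- If the walk from any site hits the next layer almost surely, then there is exactly one
sequence of stochastic matrices solving the equation for `ζ`. -/
theorem existsUnique_isZeta {ω : Env d} (hP : ∀ n i, 0 < ((ω n).P *ᵥ 1) i)
    (hs : ∀ n i, Tendsto (fun t => survival ω (n + 1) t n i) atTop (𝓝 0)) :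
    ∃! ζ, IsZeta ω ζ := by
  obtain ⟨ζ, h, h1⟩ := exists_isPassage ω
  have hone : ∀ n, ζ n *ᵥ 1 = 1 := by
    refine fun n => le_antisymm (h1 n) fun i => ?_
    have h2 : Tendsto (fun t => 1 - survival ω (n + 1) t n i) atTop (𝓝 ((1 : Fin d → ℝ) i)) := by
      simpa using tendsto_const_nhds.sub (hs n i)
    refine le_of_tendsto' h2 fun t => ?_
    have h3 := congrFun (hitMat_mulVec_one ω (n + 1) t (n := n) (by omega)) i
    simp only [Pi.sub_apply, Pi.one_apply] at h3
    rw [← h3]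
    exact mulVec_le_mulVec_of_entry_le (hitMat_le_of_isPassage h n t) zero_le_one i
  refine ⟨ζ, h.isZeta hone hP, fun ζ' h' => ?_⟩
  funext n
  ext i j
  exact tendsto_nhds_unique
    (tendsto_hitMat h'.isPassage (fun n => (h'.stochastic n).2.le) n (hs n) i j)
    (tendsto_hitMat h h1 n (hs n) i j)

/-! ### The series for the mean hitting time -/

/-- The sum of the first `K` terms of `u_n + A_n u_{n-1} + A_n A_{n-1} u_{n-2} + ⋯`. -/
noncomputable def partialMean (ω : Env d) (ζ : ℤ → Matrix (Fin d) (Fin d) ℝ) :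
    ℕ → ℤ → Fin d → ℝ
  | 0 => 0
  | K + 1 => fun n => vecU ω ζ n + matA ω ζ n *ᵥ partialMean ω ζ K (n - 1)

theorem prodA_mulVec_partialMean (ω : Env d) (ζ : ℤ → Matrix (Fin d) (Fin d) ℝ) (K k : ℕ) :
    prodA ω ζ k *ᵥ partialMean ω ζ K (-(k : ℤ))
      = ∑ j ∈ Finset.range K, prodA ω ζ (k + j) *ᵥ vecU ω ζ (-((k + j : ℕ) : ℤ)) := by
  induction K generalizing k with
  | zero => simp [partialMean]
  | succ K ih =>
    have h1 : -(k : ℤ) - 1 = -((k + 1 : ℕ) : ℤ) := by push_cast; ring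
    have h2 := ih (k + 1)
    rw [prodA, ← Matrix.mulVec_mulVec] at h2
    rw [Finset.sum_range_succ', partialMean, Matrix.mulVec_add, h1, h2, add_comm]
    congr 1
    refine Finset.sum_congr rfl fun j _ => ?_
    rw [show k + 1 + j = k + (j + 1) by ring]

theorem partialMean_zero_eq_sum (ω : Env d) (ζ : ℤ → Matrix (Fin d) (Fin d) ℝ) (K : ℕ) :
    partialMean ω ζ K 0
      = ∑ k ∈ Finset.range K, prodA ω ζ k *ᵥ vecU ω ζ (-(k : ℤ)) := by
  simpa [prodA] using prodA_mulVec_partialMean ω ζ K 0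

section

variable {ω : Env d} {ζ : ℤ → Matrix (Fin d) (Fin d) ℝ}

theorem vecU_nonneg (h : IsZeta ω ζ) (hP : ∀ n i, 0 < ((ω n).P *ᵥ 1) i) (n : ℤ) :
    0 ≤ vecU ω ζ n :=
  inv_coreMatrix_mulVec_nonneg h.stochastic hP n zero_le_one

theorem matA_mulVec_nonneg (h : IsZeta ω ζ) (hP : ∀ n i, 0 < ((ω n).P *ᵥ 1) i) (n : ℤ)
    {v : Fin d → ℝ} (hv : 0 ≤ v) : 0 ≤ matA ω ζ n *ᵥ v := by
  rw [matA, ← Matrix.mulVec_mulVec]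
  exact inv_coreMatrix_mulVec_nonneg h.stochastic hP n (mulVec_nonneg (ω n).Q_nonneg hv)

theorem prodA_mulVec_nonneg (h : IsZeta ω ζ) (hP : ∀ n i, 0 < ((ω n).P *ᵥ 1) i) (k : ℕ)
    {v : Fin d → ℝ} (hv : 0 ≤ v) : 0 ≤ prodA ω ζ k *ᵥ v := by
  induction k generalizing v with
  | zero => simpa [prodA] using hv
  | succ k ih =>
    rw [prodA, ← Matrix.mulVec_mulVec]
    exact ih (matA_mulVec_nonneg h hP _ hv)

theorem partialMean_nonneg (h : IsZeta ω ζ) (hP : ∀ n i, 0 < ((ω n).P *ᵥ 1) i) (K : ℕ) (n : ℤ) :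
    0 ≤ partialMean ω ζ K n := by
  induction K generalizing n with
  | zero => exact le_rfl
  | succ K ih => exact add_nonneg (vecU_nonneg h hP n) (matA_mulVec_nonneg h hP n (ih _))

theorem partialMean_le_succ (h : IsZeta ω ζ) (hP : ∀ n i, 0 < ((ω n).P *ᵥ 1) i) (K : ℕ) (n : ℤ) :
    partialMean ω ζ K n ≤ partialMean ω ζ (K + 1) n := by
  induction K generalizing n with
  | zero => exact partialMean_nonneg h hP 1 n
  | succ K ih =>
    have h1 := matA_mulVec_nonneg h hP n (sub_nonneg.2 (ih (n - 1)))
    rw [Matrix.mulVec_sub] at h1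
    exact add_le_add le_rfl (sub_nonneg.1 h1)

theorem partialMean_succ_eq (h : IsZeta ω ζ) (K : ℕ) (n : ℤ) :
    partialMean ω ζ (K + 1) n = 1 + (ω n).Q *ᵥ partialMean ω ζ K (n - 1)
      + returnMat ω ζ n *ᵥ partialMean ω ζ (K + 1) n := by
  have h1 : coreMatrix ω ζ n *ᵥ partialMean ω ζ (K + 1) n
      = 1 + (ω n).Q *ᵥ partialMean ω ζ K (n - 1) := by
    rw [partialMean]
    simp only [vecU, matA]
    rw [← Matrix.mulVec_mulVec, ← Matrix.mulVec_add,
      Matrix.mulVec_mulVec, Matrix.mul_nonsing_inv _ (h.isUnit_det n), Matrix.one_mulVec]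
  rw [← h1, coreMatrix_eq, Matrix.sub_mulVec, Matrix.one_mulVec, sub_add_cancel]

/-- The sum of `partialMean` over the layers from `m - k` to `m - 1`. -/
noncomputable def partialMeanTo (ω : Env d) (ζ : ℤ → Matrix (Fin d) (Fin d) ℝ) (m : ℤ) (K : ℕ) :
    ℕ → Fin d → ℝ
  | 0 => 0
  | k + 1 => partialMean ω ζ K (m - (k + 1)) + ζ (m - (k + 1)) *ᵥ partialMeanTo ω ζ m K k

theorem partialMeanTo_nonneg (h : IsZeta ω ζ) (hP : ∀ n i, 0 < ((ω n).P *ᵥ 1) i) (m : ℤ)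
    (K k : ℕ) : 0 ≤ partialMeanTo ω ζ m K k := by
  induction k with
  | zero => exact le_rfl
  | succ k ih =>
    exact add_nonneg (partialMean_nonneg h hP K _) (mulVec_nonneg (h.stochastic _).1 ih)

theorem partialMeanTo_le_succ (h : IsZeta ω ζ) (hP : ∀ n i, 0 < ((ω n).P *ᵥ 1) i) (m : ℤ)
    (K k : ℕ) : partialMeanTo ω ζ m K k ≤ partialMeanTo ω ζ m (K + 1) k := by
  induction k with
  | zero => exact le_rfl
  | succ k ih =>
    exact add_le_add (partialMean_le_succ h hP K _) (mulVec_mono (h.stochastic _).1 ih)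

theorem truncMean_le_partialMeanTo (h : IsZeta ω ζ) (hP : ∀ n i, 0 < ((ω n).P *ᵥ 1) i) (m : ℤ)
    (t k : ℕ) : truncMean ω m t (m - k) ≤ partialMeanTo ω ζ m t k := by
  induction t generalizing k with
  | zero => exact partialMeanTo_nonneg h hP m 0 k
  | succ t ih =>
    cases k with
    | zero => simp [truncMean, partialMeanTo]
    | succ k =>
      have hlt : m - ((k + 1 : ℕ) : ℤ) < m := by omega
      simp only [truncMean, hlt, if_true]
      set n : ℤ := m - ((k + 1 : ℕ) : ℤ) with hn
      have e1 : n + 1 = m - (k : ℤ) := by rw [hn]; push_cast; ring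
      have e2 : n - 1 = m - ((k + 2 : ℕ) : ℤ) := by rw [hn]; push_cast; ring
      have e3 : m - ((k : ℤ) + 1) = n := by rw [hn]; push_cast; ring
      have e4 : m - (((k + 1 : ℕ) : ℤ) + 1) = n - 1 := by rw [hn]; push_cast; ring
      have w1 : ∀ K, partialMeanTo ω ζ m K (k + 1)
          = partialMean ω ζ K n + ζ n *ᵥ partialMeanTo ω ζ m K k := by
        intro K; rw [partialMeanTo, e3]
      have w2 : ∀ K, partialMeanTo ω ζ m K (k + 2)
          = partialMean ω ζ K (n - 1) + ζ (n - 1) *ᵥ partialMeanTo ω ζ m K (k + 1) := by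
        intro K; rw [partialMeanTo, e4]
      have h1 : stepOp ω (truncMean ω m t) n ≤ (ω n).P *ᵥ partialMeanTo ω ζ m t k
          + (ω n).R *ᵥ partialMeanTo ω ζ m t (k + 1)
          + (ω n).Q *ᵥ partialMeanTo ω ζ m t (k + 2) := by
        refine add_le_add (add_le_add (mulVec_mono (ω n).P_nonneg ?_)
          (mulVec_mono (ω n).R_nonneg (ih (k + 1)))) (mulVec_mono (ω n).Q_nonneg ?_)
        · rw [e1]; exact ih k
        · rw [e2]; exact ih (k + 2)
      have h2 : (1 : Fin d → ℝ) + ((ω n).P *ᵥ partialMeanTo ω ζ m t k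
          + (ω n).R *ᵥ partialMeanTo ω ζ m t (k + 1)
          + (ω n).Q *ᵥ partialMeanTo ω ζ m t (k + 2))
          = (1 + (ω n).Q *ᵥ partialMean ω ζ t (n - 1) + returnMat ω ζ n *ᵥ partialMean ω ζ t n)
            + ζ n *ᵥ partialMeanTo ω ζ m t k := by
        have h3 := congrArg (fun M => M *ᵥ partialMeanTo ω ζ m t k) (h.isPassage n).2
        simp only [Matrix.add_mulVec, ← Matrix.mulVec_mulVec] at h3
        rw [w2, w1, returnMat]
        simp only [Matrix.add_mulVec, Matrix.mulVec_add, ← Matrix.mulVec_mulVec]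
        linear_combination -h3
      calc (1 : Fin d → ℝ) + stepOp ω (truncMean ω m t) n
          ≤ _ := add_le_add le_rfl h1
        _ = _ := h2
        _ ≤ (1 + (ω n).Q *ᵥ partialMean ω ζ t (n - 1)
              + returnMat ω ζ n *ᵥ partialMean ω ζ (t + 1) n)
            + ζ n *ᵥ partialMeanTo ω ζ m (t + 1) k :=
          add_le_add (add_le_add le_rfl (mulVec_mono (returnMat_nonneg h.stochastic n)
            (partialMean_le_succ h hP t n)))
            (mulVec_mono (h.stochastic n).1 (partialMeanTo_le_succ h hP m t k))
        _ = partialMeanTo ω ζ m (t + 1) (k + 1) := by rw [w1, ← partialMean_succ_eq h]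

theorem truncMean_le_partialMean (h : IsZeta ω ζ) (hP : ∀ n i, 0 < ((ω n).P *ᵥ 1) i) (n : ℤ)
    (t : ℕ) : truncMean ω (n + 1) t n ≤ partialMean ω ζ t n := by
  have := truncMean_le_partialMeanTo h hP (n + 1) t 1
  simpa [partialMeanTo] using this

theorem tendsto_mulVec {M : ℕ → Matrix (Fin d) (Fin d) ℝ} {M' : Matrix (Fin d) (Fin d) ℝ}
    {v : ℕ → Fin d → ℝ} {v' : Fin d → ℝ}
    (hM : ∀ i j, Tendsto (fun t => M t i j) atTop (𝓝 (M' i j)))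
    (hv : ∀ i, Tendsto (fun t => v t i) atTop (𝓝 (v' i))) (i : Fin d) :
    Tendsto (fun t => (M t *ᵥ v t) i) atTop (𝓝 ((M' *ᵥ v') i)) := by
  simp only [Matrix.mulVec, dotProduct]
  exact tendsto_finsetSum _ fun k _ => (hM i k).mul (hv k)

/-- The truncated mean hitting times of the next layer eventually exceed every number below
a partial sum of the series. -/
theorem tendsto_min_truncMean (h : IsZeta ω ζ) (hP : ∀ n i, 0 < ((ω n).P *ᵥ 1) i)
    (hs : ∀ n i, Tendsto (fun t => survival ω (n + 1) t n i) atTop (𝓝 0)) (K : ℕ) (n : ℤ)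
    (i : Fin d) :
    Tendsto (fun t => (truncMean ω (n + 1) t n ⊓ partialMean ω ζ K n) i) atTop
      (𝓝 (partialMean ω ζ K n i)) := by
  induction K generalizing n i with
  | zero =>
    have : ∀ t, (truncMean ω (n + 1) t n ⊓ partialMean ω ζ 0 n) = 0 := fun t =>
      inf_eq_right.2 (truncMean_nonneg ω (n + 1) t n)
    simp only [this]
    exact tendsto_const_nhds
  | succ K ih =>
    set w := partialMean ω ζ (K + 1) n with hw
    set y : ℕ → Fin d → ℝ := fun t => truncMean ω (n + 1) t n ⊓ w with hy
    have hmono : Monotone y := fun s t hst =>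
      inf_le_inf_right _ (truncMean_mono ω (n + 1) n hst)
    have hlim : ∀ i, ∃ l, Tendsto (fun t => y t i) atTop (𝓝 l) := fun i =>
      ⟨_, tendsto_atTop_ciSup (fun s t hst => hmono hst i)
        ⟨w i, by rintro _ ⟨t, rfl⟩; exact (inf_le_right : y t ≤ w) i⟩⟩
    choose x hx using hlim
    have hxw : x ≤ w := fun i => le_of_tendsto' (hx i) fun t => (inf_le_right : y t ≤ w) i
    set S : ℕ → Fin d → ℝ := fun t => truncMean ω (n - 1 + 1) t (n - 1) ⊓ partialMean ω ζ K (n - 1)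
      with hS
    set F : ℕ → Matrix (Fin d) (Fin d) ℝ := fun t => hitMat ω (n - 1 + 1) t (n - 1) with hF
    set r : ℕ → Fin d → ℝ := fun t =>
      1 + (ω n).R *ᵥ y t + (ω n).Q *ᵥ (S t + F t *ᵥ y t) with hr
    set r' : Fin d → ℝ :=
      1 + (ω n).R *ᵥ x + (ω n).Q *ᵥ (partialMean ω ζ K (n - 1) + ζ (n - 1) *ᵥ x) with hr'
    have hrlim : ∀ i, Tendsto (fun t => r t i) atTop (𝓝 (r' i)) := by
      have h1 : ∀ i, Tendsto (fun t => (S t + F t *ᵥ y t) i) atTop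
          (𝓝 ((partialMean ω ζ K (n - 1) + ζ (n - 1) *ᵥ x) i)) := fun i =>
        (ih (n - 1) i).add (tendsto_mulVec (tendsto_hitMat h.isPassage
          (fun n => (h.stochastic n).2.le) (n - 1) (hs (n - 1))) hx i)
      intro i
      exact (tendsto_const_nhds.add (tendsto_mulVec (M := fun _ => (ω n).R) (M' := (ω n).R)
        (fun _ _ => tendsto_const_nhds) hx i)).add (tendsto_mulVec (M := fun _ => (ω n).Q)
          (M' := (ω n).Q) (fun _ _ => tendsto_const_nhds) h1 i)
    have hrle : ∀ t, r t ≤ truncMean ω (n + 1) (t + t + 1) n := by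
      intro t
      have hyt : y t ≤ truncMean ω (n + 1) t n := inf_le_left
      have h1 : S t + F t *ᵥ y t ≤ truncMean ω (n + 1) (t + t) (n - 1) := by
        have h2 := truncMean_add_hitMat_mulVec_le ω (n - 1 + 1) t t (n := n - 1) (by omega)
        have h3 : S t + F t *ᵥ y t ≤ _ :=
          le_trans (add_le_add inf_le_left (mulVec_mono (hitMat_nonneg ω _ t _)
            (by rw [sub_add_cancel]; exact hyt))) h2
        rwa [sub_add_cancel] at h3
      rw [truncMean]
      simp only [show n < n + 1 by omega, if_true]
      rw [hr]
      beta_reduce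
      rw [add_assoc]
      refine add_le_add le_rfl (add_le_add ?_ (mulVec_mono (ω n).Q_nonneg h1))
      refine (mulVec_mono (ω n).R_nonneg (hyt.trans (truncMean_mono ω (n + 1) n
        (Nat.le_add_left t t)))).trans ?_
      exact le_add_of_nonneg_left (mulVec_nonneg (ω n).P_nonneg (truncMean_nonneg ω _ _ _))
    have hr'e : r' = w - returnMat ω ζ n *ᵥ (w - x) := by
      have h1 := partialMean_succ_eq h K n
      rw [← hw] at h1
      rw [hr', Matrix.mulVec_sub]
      simp only [returnMat, Matrix.add_mulVec, Matrix.mulVec_add, ← Matrix.mulVec_mulVec] at h1 ⊢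
      linear_combination -h1
    have hr'w : r' ≤ w := by
      rw [hr'e]
      exact sub_le_self _ (mulVec_nonneg (returnMat_nonneg h.stochastic n) (sub_nonneg.2 hxw))
    have hr'x : r' ≤ x := by
      intro i
      have h1 : Tendsto (fun t => min (r t i) (w i)) atTop (𝓝 (min (r' i) (w i))) :=
        (hrlim i).min tendsto_const_nhds
      rw [min_eq_left (hr'w i)] at h1
      have h2 : Tendsto (fun t : ℕ => t + t + 1) atTop atTop :=
        tendsto_atTop_mono (fun t => show t ≤ t + t + 1 by omega) tendsto_id
      exact le_of_tendsto_of_tendsto' h1 ((hx i).comp h2) fun t => min_le_min_right _ (hrle t i)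
    have hwx : 0 ≤ x - w := by
      refine nonneg_of_mulVec_le (returnMat_nonneg h.stochastic n)
        (returnMat_row_sum_lt h.stochastic hP n) ?_
      rw [hr'e, ← neg_sub x w, Matrix.mulVec_neg, sub_neg_eq_add] at hr'x
      rw [le_sub_iff_add_le, add_comm]
      exact hr'x
    have hxe : x = w := le_antisymm hxw (sub_nonneg.1 hwx)
    have := hx i
    rwa [hxe] at this

end

/-! ### Paths of the walk -/

theorem tsum_transProb_mul (ω : Env d) {φ : ℤ → Fin d → ℝ} (hφ : ∀ n, 0 ≤ φ n) (z : Site d) :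
    ∑' z' : Site d, ENNReal.ofReal (transProb ω z z') * ENNReal.ofReal (φ z'.1 z'.2)
      = ENNReal.ofReal (stepOp ω φ z.1 z.2) := by
  rw [ENNReal.tsum_prod', tsum_eq_sum (s := {z.1 + 1, z.1, z.1 - 1})]
  · have e1 : z.1 + 1 ∉ ({z.1, z.1 - 1} : Finset ℤ) := by
      simp only [Finset.mem_insert, Finset.mem_singleton]; omega
    have e2 : z.1 ∉ ({z.1 - 1} : Finset ℤ) := by
      simp only [Finset.mem_singleton]; omega
    rw [Finset.sum_insert e1, Finset.sum_insert e2, Finset.sum_singleton]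
    have a1 : ∀ j, transProb ω z (z.1 + 1, j) = (ω z.1).P z.2 j := by
      intro j; simp [transProb]
    have a2 : ∀ j, transProb ω z (z.1, j) = (ω z.1).R z.2 j := by
      intro j; simp [transProb]
    have a3 : ∀ j, transProb ω z (z.1 - 1, j) = (ω z.1).Q z.2 j := by
      intro j
      have b1 : ¬ (z.1 - 1 = z.1 + 1) := by omega
      simp [transProb, b1]
    simp only [a1, a2, a3, tsum_fintype]
    have key : ∀ (M : Matrix (Fin d) (Fin d) ℝ) (_ : ∀ i j, 0 ≤ M i j) (n : ℤ),
        ∑ j, ENNReal.ofReal (M z.2 j) * ENNReal.ofReal (φ n j)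
          = ENNReal.ofReal ((M *ᵥ φ n) z.2) := by
      intro M hM n
      simp only [Matrix.mulVec, dotProduct]
      rw [ENNReal.ofReal_sum_of_nonneg fun j _ => mul_nonneg (hM _ j) (hφ n j)]
      exact Finset.sum_congr rfl fun j _ => (ENNReal.ofReal_mul (hM _ j)).symm
    rw [key _ (ω z.1).P_nonneg, key _ (ω z.1).R_nonneg, key _ (ω z.1).Q_nonneg,
      ← ENNReal.ofReal_add (mulVec_nonneg (ω z.1).R_nonneg (hφ _) _)
        (mulVec_nonneg (ω z.1).Q_nonneg (hφ _) _),
      ← ENNReal.ofReal_add (mulVec_nonneg (ω z.1).P_nonneg (hφ _) _)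
        (add_nonneg (mulVec_nonneg (ω z.1).R_nonneg (hφ _) _)
        (mulVec_nonneg (ω z.1).Q_nonneg (hφ _) _)), ← add_assoc]
    rfl
  · intro n hn
    simp only [Finset.mem_insert, Finset.mem_singleton, not_or] at hn
    simp [transProb, hn.1, hn.2.1, hn.2.2]

theorem measurableSet_layer (k : ℕ) (B : Set ℤ) :
    MeasurableSet {x : ℕ → Site d | (x k).1 ∈ B} :=
  (measurable_pi_apply (X := fun _ : ℕ => Site d) k) (Set.to_countable {z : Site d | z.1 ∈ B}).measurableSet

theorem measurableSet_cylinder (s : ℕ → Site d) (K : ℕ) :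
    MeasurableSet {x : ℕ → Site d | ∀ k ≤ K, x k = s k} := by
  simp only [Set.ofPred_forall]
  exact MeasurableSet.iInter fun k => MeasurableSet.iInter fun _ =>
    measurable_pi_apply (X := fun _ : ℕ => Site d) k (measurableSet_singleton (s k))

theorem measurableSet_cylinder_stay (s : ℕ → Site d) (K t : ℕ) (B : Set ℤ) :
    MeasurableSet {x : ℕ → Site d | (∀ k ≤ K, x k = s k) ∧ ∀ r ≤ t, (x (K + r)).1 ∈ B} := by
  have h : MeasurableSet {x : ℕ → Site d | ∀ r ≤ t, (x (K + r)).1 ∈ B} := by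
    simp only [Set.ofPred_forall]
    exact MeasurableSet.iInter fun r => MeasurableSet.iInter fun _ => measurableSet_layer _ B
  exact (measurableSet_cylinder s K).inter h

theorem quenchedMeasure_cylinder_update (μ : Kernel (Env d) (Fin d)) [IsMarkovKernel μ]
    (ω : Env d) (s : ℕ → Site d) (K : ℕ) (z : Site d) :
    quenchedMeasure μ ω {x | ∀ k ≤ K + 1, x k = Function.update s (K + 1) z k}
      = quenchedMeasure μ ω {x | ∀ k ≤ K, x k = s k} * ENNReal.ofReal (transProb ω (s K) z) := by
  rw [quenchedMeasure_cylinder, quenchedMeasure_cylinder, Finset.prod_range_succ]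
  have h : ∀ k ≤ K, Function.update s (K + 1) z k = s k := fun k hk =>
    Function.update_of_ne (by omega) _ _
  rw [h 0 (Nat.zero_le _), h K le_rfl, Function.update_self, mul_assoc]
  congr 2
  refine Finset.prod_congr rfl fun k hk => ?_
  have := Finset.mem_range.1 hk
  rw [h k (by omega), h (k + 1) (by omega)]

/-- The Markov property: the probability of following the path `s` up to time `K` and then staying
in `B` during `t` more steps. Up to layer `m`, the set `B` is the set of layers below `m`. -/
theorem quenchedMeasure_cylinder_stay (μ : Kernel (Env d) (Fin d)) [IsMarkovKernel μ]
    (ω : Env d) {m : ℤ} {B : Set ℤ} (hB : ∀ n ≤ m, n ∈ B ↔ n < m) (t : ℕ) (s : ℕ → Site d)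
    (K : ℕ) (hs : (s K).1 ≤ m) :
    quenchedMeasure μ ω {x | (∀ k ≤ K, x k = s k) ∧ ∀ r ≤ t, (x (K + r)).1 ∈ B}
      = quenchedMeasure μ ω {x | ∀ k ≤ K, x k = s k}
        * ENNReal.ofReal (survival ω m t (s K).1 (s K).2) := by
  rcases hs.lt_or_eq with hlt | heq
  swap
  · have hnot : (s K).1 ∉ B := fun h => (heq ▸ (hB _ hs).1 h).false
    have h0 : survival ω m t (s K).1 = 0 := by
      cases t <;> simp [survival, heq]
    have h1 : {x : ℕ → Site d | (∀ k ≤ K, x k = s k) ∧ ∀ r ≤ t, (x (K + r)).1 ∈ B} = ∅ := by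
      ext x
      simp only [Set.mem_ofPred_eq, Set.mem_empty_iff_false, iff_false, not_and]
      intro h h'
      have h2 := h' 0 (Nat.zero_le _)
      rw [add_zero, h K le_rfl] at h2
      exact hnot h2
    rw [h1, h0]
    simp
  have hmem : (s K).1 ∈ B := (hB _ hs).2 hlt
  induction t generalizing s K with
  | zero =>
    have h1 : {x : ℕ → Site d | (∀ k ≤ K, x k = s k) ∧ ∀ r ≤ 0, (x (K + r)).1 ∈ B}
        = {x | ∀ k ≤ K, x k = s k} := by
      ext x
      simp only [Set.mem_ofPred_eq, and_iff_left_iff_imp]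
      intro h r hr
      obtain rfl : r = 0 := by omega
      rw [add_zero, h K le_rfl]
      exact hmem
    rw [h1]
    simp [survival, hlt]
  | succ t ih =>
    have h1 : {x : ℕ → Site d | (∀ k ≤ K, x k = s k) ∧ ∀ r ≤ t + 1, (x (K + r)).1 ∈ B}
        = ⋃ z : Site d, {x | (∀ k ≤ K + 1, x k = Function.update s (K + 1) z k) ∧
            ∀ r ≤ t, (x (K + 1 + r)).1 ∈ B} := by
      ext x
      simp only [Set.mem_ofPred_eq, Set.mem_iUnion]
      constructor
      · rintro ⟨h, h'⟩
        refine ⟨x (K + 1), fun k hk => ?_, fun r hr => ?_⟩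
        · rcases Nat.lt_or_ge K k with hlt | hge
          · obtain rfl : k = K + 1 := by omega
            rw [Function.update_self]
          · rw [Function.update_of_ne (by omega), h k hge]
        · rw [show K + 1 + r = K + (r + 1) by ring]
          exact h' _ (by omega)
      · rintro ⟨z, h, h'⟩
        have h2 : ∀ k ≤ K, x k = s k := fun k hk => by
          rw [h k (by omega), Function.update_of_ne (by omega)]
        refine ⟨h2, fun r hr => ?_⟩
        cases r with
        | zero => rw [add_zero, h2 K le_rfl]; exact hmem
        | succ r =>
          rw [show K + (r + 1) = K + 1 + r by ring]
          exact h' r (by omega)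
    rw [h1, measure_iUnion]
    rotate_left
    · intro z z' hne
      refine Set.disjoint_left.2 fun x hx hx' => hne ?_
      have a := hx.1 (K + 1) le_rfl
      have b := hx'.1 (K + 1) le_rfl
      rw [Function.update_self] at a b
      rw [← a, ← b]
    · exact fun z => measurableSet_cylinder_stay _ _ _ _
    have h2 : ∀ z : Site d, quenchedMeasure μ ω
          {x | (∀ k ≤ K + 1, x k = Function.update s (K + 1) z k) ∧
            ∀ r ≤ t, (x (K + 1 + r)).1 ∈ B}
        = quenchedMeasure μ ω {x | ∀ k ≤ K, x k = s k} *
          (ENNReal.ofReal (transProb ω (s K) z) * ENNReal.ofReal (survival ω m t z.1 z.2)) := by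
      intro z
      rcases lt_or_ge m z.1 with hz | hz
      · have h3 : transProb ω (s K) z = 0 := by
          have b1 : ¬ (z.1 = (s K).1 + 1) := by omega
          have b2 : ¬ (z.1 = (s K).1) := by omega
          have b3 : ¬ (z.1 = (s K).1 - 1) := by omega
          simp [transProb, b1, b2, b3]
        rw [h3, ENNReal.ofReal_zero, zero_mul, mul_zero]
        have h4 := quenchedMeasure_cylinder_update μ ω s K z
        rw [h3, ENNReal.ofReal_zero, mul_zero] at h4
        exact measure_mono_null (fun x hx => hx.1) h4
      · rcases hz.lt_or_eq with hz' | hz'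
        · have := ih (Function.update s (K + 1) z) (K + 1) (by rwa [Function.update_self])
            (by rwa [Function.update_self])
            (by rw [Function.update_self]; exact (hB _ hz).2 hz')
          rw [this, Function.update_self, quenchedMeasure_cylinder_update, mul_assoc]
        · have h4 : survival ω m t z.1 = 0 := by
            cases t <;> simp [survival, hz']
          have h5 : {x : ℕ → Site d | (∀ k ≤ K + 1, x k = Function.update s (K + 1) z k) ∧
              ∀ r ≤ t, (x (K + 1 + r)).1 ∈ B} = ∅ := by
            ext x
            simp only [Set.mem_ofPred_eq, Set.mem_empty_iff_false, iff_false, not_and]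
            intro h h'
            have h6 := h' 0 (Nat.zero_le _)
            rw [add_zero, h (K + 1) le_rfl, Function.update_self] at h6
            exact (hz' ▸ (hB _ hz).1 h6).false
          rw [h4, h5]
          simp
    simp_rw [h2]
    rw [ENNReal.tsum_mul_left, tsum_transProb_mul ω (survival_nonneg ω m t)]
    simp only [survival, hlt, if_true]

theorem quenchedMeasure_avoid (μ : Kernel (Env d) (Fin d)) [IsMarkovKernel μ] (ω : Env d) (t : ℕ) :
    quenchedMeasure μ ω {x | ∀ r ≤ t, (x r).1 ≠ 1}
      = ∑ i, μ ω {i} * ENNReal.ofReal (survival ω 1 t 0 i) := by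
  have h1 : {x : ℕ → Site d | ∀ r ≤ t, (x r).1 ≠ 1}
      = ⋃ z : Site d, {x | (∀ k ≤ 0, x k = (fun _ => z) k) ∧
          ∀ r ≤ t, (x (0 + r)).1 ∈ ({1}ᶜ : Set ℤ)} := by
    ext x
    simp
  rw [h1, measure_iUnion]
  rotate_left
  · intro z z' hne
    refine Set.disjoint_left.2 fun x hx hx' => hne ?_
    exact (hx.1 0 le_rfl).symm.trans (hx'.1 0 le_rfl)
  · exact fun z => measurableSet_cylinder_stay _ _ _ _
  have hB : ∀ n ≤ (1 : ℤ), n ∈ ({1}ᶜ : Set ℤ) ↔ n < 1 := fun n hn => by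
    simp only [Set.mem_compl_iff, Set.mem_singleton_iff]; omega
  have h2 : ∀ z : Site d, quenchedMeasure μ ω {x | (∀ k ≤ 0, x k = (fun _ => z) k) ∧
          ∀ r ≤ t, (x (0 + r)).1 ∈ ({1}ᶜ : Set ℤ)}
      = if z.1 = 0 then μ ω {z.2} * ENNReal.ofReal (survival ω 1 t 0 z.2) else 0 := by
    intro z
    have h3 := quenchedMeasure_cylinder μ ω (fun _ => z) 0
    simp only [Finset.range_zero, Finset.prod_empty, mul_one] at h3
    split_ifs with hz
    · rw [quenchedMeasure_cylinder_stay μ ω hB t (fun _ => z) 0 (by simp [hz]), h3, if_pos hz, hz]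
    · rw [if_neg hz] at h3
      exact measure_mono_null (fun x hx => hx.1) h3
  simp_rw [h2]
  rw [ENNReal.tsum_prod', tsum_eq_single 0]
  · simp [tsum_fintype]
  · intro n hn
    simp [hn]

theorem toENNReal_hittingTime (m : ℤ) (x : ℕ → Site d) :
    ((hittingTime m x : ℕ∞) : ℝ≥0∞)
      = ∑' t : ℕ, {x : ℕ → Site d | ∀ r ≤ t, (x r).1 ≠ m}.indicator 1 x := by
  by_cases h : ∃ t, (x t).1 = m
  · classical
    have hT : hittingTime m x = (Nat.find h : ℕ) := by
      refine le_antisymm (iInf₂_le (Nat.find h) (Nat.find_spec h)) ?_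
      exact le_iInf₂ fun t ht => by exact_mod_cast Nat.find_min' h ht
    rw [hT, tsum_eq_sum (s := Finset.range (Nat.find h))]
    · rw [Finset.sum_congr rfl (g := fun _ => (1 : ℝ≥0∞))]
      · simp
      · intro t ht
        rw [Set.indicator_of_mem]
        · rfl
        · intro r hr
          exact Nat.find_min h (lt_of_le_of_lt hr (Finset.mem_range.1 ht))
    · intro t ht
      rw [Set.indicator_of_notMem]
      intro h'
      exact h' _ (by simpa using ht) (Nat.find_spec h)
  · push Not at h
    have hT : hittingTime m x = ⊤ := by
      simp only [hittingTime, iInf_eq_top]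
      exact fun t ht => absurd ht (h t)
    have h1 : ∀ t : ℕ, {x : ℕ → Site d | ∀ r ≤ t, (x r).1 ≠ m}.indicator (1 : (ℕ → Site d) → ℝ≥0∞) x = 1 := by
      intro t
      rw [Set.indicator_of_mem]
      · rfl
      · exact fun r _ => h r
    simp_rw [hT, h1]
    simp

theorem measurableSet_avoid (m : ℤ) (t : ℕ) :
    MeasurableSet {x : ℕ → Site d | ∀ r ≤ t, (x r).1 ≠ m} := by
  simp only [Set.ofPred_forall]
  exact MeasurableSet.iInter fun r => MeasurableSet.iInter fun _ => measurableSet_layer r {m}ᶜ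

theorem measurable_hittingTime (m : ℤ) :
    Measurable fun x : ℕ → Site d => ((hittingTime m x : ℕ∞) : ℝ≥0∞) := by
  simp_rw [toENNReal_hittingTime]
  exact Measurable.tsum fun t => measurable_one.indicator (measurableSet_avoid m t)

theorem lintegral_hittingTime (μ : Kernel (Env d) (Fin d)) [IsMarkovKernel μ] (ω : Env d) :
    ∫⁻ x, ((hittingTime 1 x : ℕ∞) : ℝ≥0∞) ∂(quenchedMeasure μ ω)
      = ∑' t : ℕ, ENNReal.ofReal (rowVec (μ ω) ⬝ᵥ survival ω 1 t 0) := by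
  simp_rw [toENNReal_hittingTime]
  rw [lintegral_tsum fun t => (measurable_one.indicator (measurableSet_avoid 1 t)).aemeasurable]
  refine tsum_congr fun t => ?_
  rw [lintegral_indicator_one (measurableSet_avoid 1 t), quenchedMeasure_avoid, dotProduct,
    ENNReal.ofReal_sum_of_nonneg
      fun i _ => mul_nonneg (show 0 ≤ rowVec (μ ω) i from measureReal_nonneg) (survival_nonneg ω 1 t 0 i)]
  refine Finset.sum_congr rfl fun i _ => ?_
  rw [rowVec, ENNReal.ofReal_mul measureReal_nonneg, ofReal_measureReal]

/-- The quenched mean hitting time of layer `1`. -/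
theorem lintegral_hittingTime_eq_tsum (μ : Kernel (Env d) (Fin d)) [IsMarkovKernel μ]
    {ω : Env d} {ζ : ℤ → Matrix (Fin d) (Fin d) ℝ} (h : IsZeta ω ζ)
    (hP : ∀ n i, 0 < ((ω n).P *ᵥ 1) i)
    (hs : ∀ n i, Tendsto (fun t => survival ω (n + 1) t n i) atTop (𝓝 0)) :
    ∫⁻ x, ((hittingTime 1 x : ℕ∞) : ℝ≥0∞) ∂(quenchedMeasure μ ω)
      = ∑' k : ℕ, ENNReal.ofReal
          (rowVec (μ ω) ⬝ᵥ (prodA ω ζ k *ᵥ vecU ω ζ (-(k : ℤ)))) := by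
  have hμ : 0 ≤ rowVec (μ ω) := fun i => measureReal_nonneg
  have hdot : ∀ {v w : Fin d → ℝ}, v ≤ w → rowVec (μ ω) ⬝ᵥ v ≤ rowVec (μ ω) ⬝ᵥ w := fun h =>
    dotProduct_le_dotProduct_of_nonneg_left h hμ
  have h1 : ∀ N, ∑ t ∈ Finset.range N, ENNReal.ofReal (rowVec (μ ω) ⬝ᵥ survival ω 1 t 0)
      = ENNReal.ofReal (rowVec (μ ω) ⬝ᵥ truncMean ω 1 N 0) := by
    intro N
    rw [truncMean_eq_sum, dotProduct_sum, ENNReal.ofReal_sum_of_nonneg]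
    exact fun t _ => dotProduct_nonneg_of_nonneg hμ (survival_nonneg ω 1 t 0)
  have h2 : ∀ N, ∑ k ∈ Finset.range N, ENNReal.ofReal
        (rowVec (μ ω) ⬝ᵥ (prodA ω ζ k *ᵥ vecU ω ζ (-(k : ℤ))))
      = ENNReal.ofReal (rowVec (μ ω) ⬝ᵥ partialMean ω ζ N 0) := by
    intro N
    rw [partialMean_zero_eq_sum, dotProduct_sum, ENNReal.ofReal_sum_of_nonneg]
    exact fun k _ => dotProduct_nonneg_of_nonneg hμ
      (prodA_mulVec_nonneg h hP k (vecU_nonneg h hP _))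
  rw [lintegral_hittingTime, ENNReal.tsum_eq_iSup_nat, ENNReal.tsum_eq_iSup_nat]
  simp_rw [h1, h2]
  refine le_antisymm (iSup_mono fun N => ENNReal.ofReal_le_ofReal (hdot ?_)) (iSup_le fun K => ?_)
  · have := truncMean_le_partialMean h hP 0 N
    rwa [zero_add] at this
  · have h3 : Tendsto (fun t => rowVec (μ ω) ⬝ᵥ (truncMean ω 1 t 0 ⊓ partialMean ω ζ K 0)) atTop
        (𝓝 (rowVec (μ ω) ⬝ᵥ partialMean ω ζ K 0)) := by
      simp only [dotProduct]
      refine tendsto_finsetSum _ fun i _ => tendsto_const_nhds.mul ?_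
      have := tendsto_min_truncMean h hP hs K 0 i
      rwa [zero_add] at this
    refine le_of_tendsto' ((ENNReal.continuous_ofReal.tendsto _).comp h3) fun t => ?_
    exact le_iSup_of_le t (ENNReal.ofReal_le_ofReal (hdot inf_le_left))

/-! ### Irreducibility of almost every environment -/

theorem shift_iterate_apply (k : ℕ) (ω : Env d) (n : ℤ) : (shift^[k] ω) n = ω (n + k) := by
  induction k generalizing ω with
  | zero => simp
  | succ k ih =>
    rw [Function.iterate_succ_apply, ih, shift]
    congr 1
    push_cast
    ring

theorem transProb_shift_iterate (k : ℕ) (ω : Env d) (z z' : Site d) :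
    transProb (shift^[k] ω) z z' = transProb ω (z.1 + k, z.2) (z'.1 + k, z'.2) := by
  have h1 : z'.1 + (k : ℤ) = z.1 + k + 1 ↔ z'.1 = z.1 + 1 := by omega
  have h2 : z'.1 + (k : ℤ) = z.1 + k ↔ z'.1 = z.1 := by omega
  have h3 : z'.1 + (k : ℤ) = z.1 + k - 1 ↔ z'.1 = z.1 - 1 := by omega
  simp only [transProb, shift_iterate_apply, h1, h2, h3]

theorem Reachable.of_shift_iterate {k : ℕ} {ω : Env d} {z z' : Site d}
    (h : Reachable (shift^[k] ω) z z') : Reachable ω (z.1 + k, z.2) (z'.1 + k, z'.2) :=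
  Relation.ReflTransGen.lift (r := fun a b => 0 < transProb (shift^[k] ω) a b)
    (p := fun a b => 0 < transProb ω a b) (fun z : Site d => ((z.1 + k, z.2) : Site d))
    (fun a b hab => by
      simp only [transProb_shift_iterate] at hab
      exact hab) _ _ h

/-- The walk moves from `z` to `z'` with positive probability in `n` steps. -/
def ReachableIn (ω : Env d) (z : Site d) : ℕ → Site d → Prop
  | 0, z' => z = z'
  | n + 1, z' => ∃ y, ReachableIn ω z n y ∧ 0 < transProb ω y z'

theorem reachable_iff_exists_reachableIn (ω : Env d) (z z' : Site d) :
    Reachable ω z z' ↔ ∃ n, ReachableIn ω z n z' := by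
  constructor
  · intro h
    induction h with
    | refl => exact ⟨0, rfl⟩
    | tail _ h ih =>
      obtain ⟨n, hn⟩ := ih
      exact ⟨n + 1, _, hn, h⟩
  · rintro ⟨n, hn⟩
    induction n generalizing z' with
    | zero => obtain rfl : z = z' := hn; exact Relation.ReflTransGen.refl
    | succ n ih =>
      obtain ⟨y, hy, hy'⟩ := hn
      exact (ih y hy).tail hy'

theorem measurableSet_reachableIn (z : Site d) (n : ℕ) (z' : Site d) :
    MeasurableSet {ω : Env d | ReachableIn ω z n z'} := by
  induction n generalizing z' with
  | zero => exact MeasurableSet.const _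
  | succ n ih =>
    simp only [ReachableIn, Set.ofPred_exists]
    exact MeasurableSet.iUnion fun y =>
      (ih y).inter (measurableSet_lt measurable_const (measurable_transProb y z'))

theorem measurableSet_reachable (z z' : Site d) :
    MeasurableSet {ω : Env d | Reachable ω z z'} := by
  simp only [reachable_iff_exists_reachableIn, Set.ofPred_exists]
  exact MeasurableSet.iUnion fun n => measurableSet_reachableIn z n z'

/-- An ergodic map visits a set of positive measure infinitely often from almost every point. -/
theorem ae_frequently_iterate_mem {α : Type*} [MeasurableSpace α] {ν : Measure α}
    [IsFiniteMeasure ν] {f : α → α} (hf : Ergodic f ν) {s : Set α} (hs : MeasurableSet s)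
    (h0 : 0 < ν s) : ∀ᵐ x ∂ν, ∃ᶠ n in atTop, f^[n] x ∈ s := by
  set A : Set α := {x | ∃ᶠ n in atTop, f^[n] x ∈ s} with hA
  have hAm : MeasurableSet A := by
    have : A = ⋂ N : ℕ, ⋃ n ∈ Set.Ici N, f^[n] ⁻¹' s := by
      ext x
      simp [hA, frequently_atTop]
    rw [this]
    exact MeasurableSet.iInter fun N => MeasurableSet.biUnion (Set.to_countable _)
      fun n _ => hf.measurable.iterate n hs
  have hinv : f ⁻¹' A = A := by
    ext x
    simp only [hA, Set.mem_preimage, Set.mem_ofPred_eq, ← Function.iterate_succ_apply]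
    conv_rhs => rw [← map_add_atTop_eq_nat 1, frequently_map]
  rcases hf.toPreErgodic.ae_mem_or_ae_notMem hAm hinv with h | h
  · exact h
  · exfalso
    have h1 := hf.toMeasurePreserving.conservative.ae_mem_imp_frequently_image_mem
      hs.nullMeasurableSet
    refine h0.ne' (measure_eq_zero_iff_ae_notMem.2 ?_)
    filter_upwards [h, h1] with x hx hx' hxs
    exact hx (hx' hxs)

/-- If `P` has positive row sums, `Q` has positive column sums and infinitely many layers to the
right communicate, then any site is reachable from any other. -/
theorem reachable_of_frequently {ω : Env d} (hP : ∀ n i, 0 < ((ω n).P *ᵥ 1) i)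
    (hQ : ∀ n j, 0 < ∑ i, (ω n).Q i j)
    (hC : ∃ᶠ k : ℕ in atTop, ∀ i j : Fin d, Reachable ω ((k : ℤ), i) ((k : ℤ), j))
    (z z' : Site d) : Reachable ω z z' := by
  have refl : ∀ z, Reachable ω z z := fun _ => Relation.ReflTransGen.refl
  have pos : ∀ f : Fin d → ℝ, 0 < ∑ i, f i → ∃ i, 0 < f i := by
    intro f hf
    by_contra! h
    exact hf.not_ge (Finset.sum_nonpos fun i _ => h i)
  have up : ∀ (k : ℕ) (z : Site d), ∃ j, Reachable ω z (z.1 + k, j) := by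
    intro k z
    induction k with
    | zero => exact ⟨z.2, by simpa using refl z⟩
    | succ k ih =>
      obtain ⟨j, hj⟩ := ih
      have h1 := hP (z.1 + k) j
      simp only [Matrix.mulVec, dotProduct, Pi.one_apply, mul_one] at h1
      obtain ⟨l, hl⟩ := pos _ h1
      refine ⟨l, hj.tail ?_⟩
      have e : z.1 + ((k + 1 : ℕ) : ℤ) = z.1 + k + 1 := by push_cast; ring
      simp only [transProb]
      rw [if_pos e]
      exact hl
  have down : ∀ (k : ℕ) (z : Site d), ∃ i, Reachable ω (z.1 + k, i) z := by
    intro k z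
    induction k with
    | zero => exact ⟨z.2, by simpa using refl z⟩
    | succ k ih =>
      obtain ⟨j, hj⟩ := ih
      obtain ⟨l, hl⟩ := pos _ (hQ (z.1 + (k + 1 : ℕ)) j)
      refine ⟨l, Relation.ReflTransGen.head ?_ hj⟩
      have b1 : ¬ (z.1 + (k : ℤ) = z.1 + ((k + 1 : ℕ) : ℤ) + 1) := by omega
      have b2 : ¬ (z.1 + (k : ℤ) = z.1 + ((k + 1 : ℕ) : ℤ)) := by omega
      have b3 : z.1 + (k : ℤ) = z.1 + ((k + 1 : ℕ) : ℤ) - 1 := by omega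
      simp only [transProb]
      rw [if_neg b1, if_neg b2, if_pos b3]
      exact hl
  obtain ⟨k, hk, hkC⟩ := (frequently_atTop.1 hC) (max z.1 z'.1).toNat
  have hz : z.1 ≤ k := by omega
  have hz' : z'.1 ≤ k := by omega
  obtain ⟨j, hj⟩ := up ((k : ℤ) - z.1).toNat z
  obtain ⟨i, hi⟩ := down ((k : ℤ) - z'.1).toNat z'
  rw [show z.1 + (((k : ℤ) - z.1).toNat : ℤ) = k by omega] at hj
  rw [show z'.1 + (((k : ℤ) - z'.1).toNat : ℤ) = k by omega] at hi
  exact (hj.trans (hkC j i)).trans hi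

theorem pos_P_mulVec_one {L : Layer d} (h : rowNorm (L.R + L.Q) < 1) (i : Fin d) :
    0 < (L.P *ᵥ 1) i := by
  have h1 : ∑ j, |(L.R + L.Q) i j| ≤ rowNorm (L.R + L.Q) :=
    le_ciSup (f := fun i => ∑ j, |(L.R + L.Q) i j|) (Set.finite_range _).bddAbove i
  have h2 : ((L.R + L.Q) *ᵥ 1) i ≤ ∑ j, |(L.R + L.Q) i j| := by
    simp only [Matrix.mulVec, dotProduct, Pi.one_apply, mul_one]
    exact Finset.sum_le_sum fun j _ => le_abs_self _
  have h3 := congrFun L.row_sum i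
  simp only [Matrix.add_mulVec, Pi.add_apply, Pi.one_apply] at h2 h3
  linarith

theorem ConditionC.ae_reachable {Pr : Measure (Env d)} [IsProbabilityMeasure Pr]
    (hC : ConditionC Pr) :
    ∀ᵐ ω ∂Pr, (∀ n i, 0 < ((ω n).P *ᵥ 1) i) ∧ ∀ z z', Reachable ω z z' := by
  have hm : MeasurableSet {ω : Env d | ∀ i j : Fin d, Reachable ω (0, i) (0, j)} := by
    simp only [Set.ofPred_forall]
    exact MeasurableSet.iInter fun i => MeasurableSet.iInter fun j => measurableSet_reachable _ _
  have h1 := ae_frequently_iterate_mem hC.ergodic hm hC.communicate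
  have h2 : ∀ᵐ ω ∂Pr, ∀ n, rowNorm ((ω n).R + (ω n).Q) < 1 := ae_all_iff.2 hC.lt_one_left
  have h3 : ∀ᵐ ω ∂Pr, ∀ n j, 0 < ∑ i, (ω n).Q i j :=
    ae_all_iff.2 fun n => ae_all_iff.2 fun j => (hC.columns_pos j n).mono fun ω h => h.1
  filter_upwards [h1, h2, h3] with ω hω1 hω2 hω3
  have hP : ∀ n i, 0 < ((ω n).P *ᵥ 1) i := fun n => pos_P_mulVec_one (hω2 n)
  refine ⟨hP, reachable_of_frequently hP hω3 (hω1.mono fun k hk i j => ?_)⟩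
  have := (hk i j).of_shift_iterate
  simpa using this

/-! ### Transience to the right -/

theorem survival_antitone (ω : Env d) (m n : ℤ) : Antitone fun t => survival ω m t n := by
  refine antitone_nat_of_succ_le fun t => ?_
  induction t generalizing n with
  | zero =>
    simp only [survival]
    split_ifs with h
    · have h1 : stepOp ω (fun n : ℤ => if n < m then (1 : Fin d → ℝ) else 0) n
          ≤ stepOp ω (fun _ => 1) n := by
        have : ∀ k : ℤ, (if k < m then (1 : Fin d → ℝ) else 0) ≤ 1 := by
          intro k; split_ifs
          · exact le_rfl
          · exact zero_le_one
        exact stepOp_mono (this _) (this _) (this _)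
      exact h1.trans (ω n).row_sum.le
    · exact le_rfl
  | succ t ih =>
    rw [survival, survival]
    beta_reduce
    split_ifs with h
    · exact stepOp_mono (ih _) (ih _) (ih _)
    · exact le_rfl

theorem Reachable.exists_path {ω : Env d} {z z' : Site d} (h : Reachable ω z z') :
    ∃ (K : ℕ) (s : ℕ → Site d), s 0 = z ∧ s K = z' ∧
      ∀ k < K, 0 < transProb ω (s k) (s (k + 1)) := by
  induction h with
  | refl => exact ⟨0, fun _ => z, rfl, rfl, fun k hk => absurd hk (Nat.not_lt_zero k)⟩
  | @tail b c _ h ih =>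
    obtain ⟨K, s, h0, hK, hs⟩ := ih
    have hu : ∀ k ≤ K, Function.update s (K + 1) c k = s k := fun k hk =>
      Function.update_of_ne (by omega) _ _
    refine ⟨K + 1, Function.update s (K + 1) c, ?_, Function.update_self _ _ _, fun k hk => ?_⟩
    · rw [hu 0 (Nat.zero_le _), h0]
    · rcases Nat.lt_or_ge k K with hlt | hge
      · rw [hu k hlt.le, hu (k + 1) hlt]
        exact hs k hlt
      · obtain rfl : k = K := by omega
        rw [hu k le_rfl, Function.update_self, hK]
        exact h

/-- In an irreducible environment where the walk tends to `+∞`, it hits every layer to the right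
of any site. -/
theorem tendsto_survival_zero (μ : Kernel (Env d) (Fin d)) [IsMarkovKernel μ] {ω : Env d}
    (hR : ∀ z z', Reachable ω z z')
    (ht : ∀ᵐ x ∂(quenchedMeasure μ ω), Tendsto (fun t => (x t).1) atTop atTop)
    (m n : ℤ) (i : Fin d) : Tendsto (fun t => survival ω m t n i) atTop (𝓝 0) := by
  rcases le_or_gt m n with hmn | hmn
  · have : ∀ t, survival ω m t n i = 0 := by
      intro t
      cases t <;> simp [survival, hmn.not_gt]
    simp [this]
  have hanti : Antitone fun t => survival ω m t n i := fun s t h => survival_antitone ω m n h i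
  have hlim := tendsto_atTop_ciInf hanti ⟨0, by
    rintro _ ⟨t, rfl⟩; exact survival_nonneg ω m t n i⟩
  set l : ℝ := ⨅ t, survival ω m t n i with hl
  have hle : ∀ t, l ≤ survival ω m t n i := fun t => hanti.le_of_tendsto hlim t
  have hl0 : 0 ≤ l := ge_of_tendsto' hlim fun t => survival_nonneg ω m t n i
  rcases hl0.eq_or_lt with h0 | hpos
  · rwa [← h0] at hlim
  exfalso
  obtain ⟨y, hy⟩ : ∃ y, μ ω {y} ≠ 0 := by
    by_contra! h
    have h1 : μ ω Set.univ = 0 := by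
      rw [← Set.iUnion_of_singleton, measure_iUnion_null_iff]
      exact h
    rw [measure_univ] at h1
    exact one_ne_zero h1
  obtain ⟨K, s, hs0, hsK, hs⟩ := (hR (0, y) (n, i)).exists_path
  set c : ℝ≥0∞ := quenchedMeasure μ ω {x | ∀ k ≤ K, x k = s k} with hc
  have hcpos : c ≠ 0 := by
    rw [hc, quenchedMeasure_cylinder, hs0, if_pos rfl]
    refine mul_ne_zero hy (Finset.prod_ne_zero_iff.2 fun k hk => ?_)
    exact (ENNReal.ofReal_pos.2 (hs k (Finset.mem_range.1 hk))).ne'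
  set G : ℕ → Set (ℕ → Site d) := fun t =>
    {x | (∀ k ≤ K, x k = s k) ∧ ∀ r ≤ t, (x (K + r)).1 ∈ Set.Iio m} with hG
  have hGm : ∀ t, quenchedMeasure μ ω (G t) = c * ENNReal.ofReal (survival ω m t n i) := by
    intro t
    have := quenchedMeasure_cylinder_stay μ ω (m := m) (B := Set.Iio m) (fun _ _ => Iff.rfl) t s K
      (by rw [hsK]; exact hmn.le)
    rwa [hsK] at this
  have hGanti : Antitone G := fun t t' h x hx => ⟨hx.1, fun r hr => hx.2 r (hr.trans h)⟩
  have hGi : c * ENNReal.ofReal l ≤ quenchedMeasure μ ω (⋂ t, G t) := by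
    rw [hGanti.measure_iInter (fun t => (measurableSet_cylinder_stay s K t _).nullMeasurableSet)
      ⟨0, measure_ne_top _ _⟩]
    refine le_iInf fun t => ?_
    rw [hGm]
    gcongr
    exact hle t
  have hnull : quenchedMeasure μ ω (⋂ t, G t) = 0 := by
    refine measure_eq_zero_iff_ae_notMem.2 (ht.mono fun x hx hxG => ?_)
    obtain ⟨t, htm, htK⟩ := ((hx.eventually_ge_atTop m).and (eventually_ge_atTop K)).exists
    have h1 := (Set.mem_iInter.1 hxG (t - K)).2 (t - K) le_rfl
    rw [Nat.add_sub_cancel' htK] at h1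
    exact absurd htm (not_le.2 h1)
  rw [hnull, nonpos_iff_eq_zero, mul_eq_zero] at hGi
  exact hGi.elim hcpos (ENNReal.ofReal_pos.2 hpos).ne'

theorem ae_tendsto_survival_zero {Pr : Measure (Env d)} [IsProbabilityMeasure Pr]
    (hC : ConditionC Pr) (μ : Kernel (Env d) (Fin d)) [IsMarkovKernel μ]
    (htrans : ∀ᵐ p ∂(annealed Pr μ), Tendsto (fun t => (p.2 t).1) atTop atTop) :
    ∀ᵐ ω ∂Pr, (∀ n i, 0 < ((ω n).P *ᵥ 1) i) ∧
      ∀ n i, Tendsto (fun t => survival ω (n + 1) t n i) atTop (𝓝 0) := by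
  filter_upwards [hC.ae_reachable, Measure.ae_ae_of_ae_compProd htrans] with ω hω ht
  exact ⟨hω.1, fun n i => tendsto_survival_zero μ hω.2 ht (n + 1) n i⟩

theorem lintegral_annealed_hittingTime (Pr : Measure (Env d)) [IsProbabilityMeasure Pr]
    (μ : Kernel (Env d) (Fin d)) [IsMarkovKernel μ] (m : ℤ) :
    ∫⁻ p, ((hittingTime m p.2 : ℕ∞) : ℝ≥0∞) ∂(annealed Pr μ)
      = ∫⁻ ω, ∫⁻ x, ((hittingTime m x : ℕ∞) : ℝ≥0∞) ∂(quenchedMeasure μ ω) ∂Pr := by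
  have h : Measurable fun p : Env d × (ℕ → Site d) => ((hittingTime m p.2 : ℕ∞) : ℝ≥0∞) :=
    (measurable_hittingTime m).comp measurable_snd
  rw [annealed, Measure.lintegral_compProd h]
  rfl

end StripRWRE

theorem theorem2 {d : ℕ} (hd : 1 ≤ d)
    (Pr : Measure (StripRWRE.Env d)) [IsProbabilityMeasure Pr]
    (hC : StripRWRE.ConditionC Pr)
    (μ : Kernel (StripRWRE.Env d) (Fin d)) [IsMarkovKernel μ]
    (htrans : ∀ᵐ p ∂(StripRWRE.annealed Pr μ), Tendsto (fun t => (p.2 t).1) atTop atTop) :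
    (∀ᵐ ω ∂Pr, ∃! ζ, StripRWRE.IsZeta ω ζ) ∧
    ∀ ζ : StripRWRE.Env d → ℤ → Matrix (Fin d) (Fin d) ℝ,
      (∀ᵐ ω ∂Pr, StripRWRE.IsZeta ω (ζ ω)) →
      ∫⁻ p, ((StripRWRE.hittingTime 1 p.2 : ℕ∞) : ℝ≥0∞) ∂(StripRWRE.annealed Pr μ) =
        ∫⁻ ω, ∑' k : ℕ, ENNReal.ofReal
          (StripRWRE.rowVec (μ ω) ⬝ᵥ
            (StripRWRE.prodA ω (ζ ω) k *ᵥ StripRWRE.vecU ω (ζ ω) (-(k : ℤ)))) ∂Pr := by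
  have hsurv := StripRWRE.ae_tendsto_survival_zero hC μ htrans
  refine ⟨hsurv.mono fun ω h => StripRWRE.existsUnique_isZeta h.1 h.2, fun ζ hζ => ?_⟩
  rw [StripRWRE.lintegral_annealed_hittingTime]
  refine lintegral_congr_ae ?_
  filter_upwards [hsurv, hζ] with ω h hω
  exact StripRWRE.lintegral_hittingTime_eq_tsum μ hω h.1 h.2
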